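/- **Setting.** For a locally compact Hausdorff space $K$ let $M(K)$ be the Banach space of regular complex Borel measures on $K$ with the total variation norm $\|\mu\|=|\mu|(K)$, $M^+(K)$ the set of its non-negative elements, $P(K)$ the set of its probability measures, and $p_x$ the point mass at $x$. The cone topology on $M^+(K)$ is the weakest topology for which $\mu\mapsto\int f\,d\mu$ is continuous for every $f\in C_c^+(K)\cup\{1_K\}$. The Michael topology on the set $\mathfrak C(K)$ of compact subsets of $K$ is generated by the sets $\{C: C\cap U\neq\emptyset,\ C\subseteq V\}$ with $U,V\subseteq K$ open. A *semitopological semihypergroup* is a non-empty locally compact Hausdorff space $K$ with a product $*$ on $M(K)$ such that $(M(K),*)$ is an associative complex algebra; $*$ maps $M^+(K)\times M^+(K)$ into $M^+(K)$ and is separately continuous there for the cone topology; $p_x*p_y$ is a probability measure with compact support for all $x,y\in K$; and $(x,y)\mapsto\operatorname{supp}(p_x*p_y)$ is separately continuous from $K\times K$ into $\mathfrak C(K)$ with the Michael topology. Then $M(K)$ is a Banach algebra. For $\phi\in M(K)^*$ and $\mu\in M(K)$ put $L_\mu\phi(\nu)=\phi(\mu*\nu)$ and $R_\mu\phi(\nu)=\phi(\nu*\mu)$,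 and let $\mathbb 1\in M(K)^*$ be $\mathbb 1(\mu)=\mu(K)$. A *mean* is a linear functional $m$ on $M(K)^*$ with $\|m\|=1$ and $m(\phi)\ge 0$ whenever $\phi\ge0$ (that is, $\phi(\mu)\geq 0$ for all $\mu\in M^+(K)$); it is a *topological left invariant mean* (TLIM) if $m(L_\nu\phi)=m(\phi)$ for all $\nu\in P(K)$, $\phi\in M(K)^*$. $K$ is *topological right stationary* if there is a net $(\nu_\alpha)$ in $P(K)$ such that for each $\phi\in M(K)^*$ there is $c\in\mathbb C$ with $R_{\nu_\alpha}\phi\to c\,\mathbb 1$ in the weak$^*$ topology of $M(K)^*$. An *F-algebra* (Lau algebra) is a Banach algebra $A$ that is the predual of a W$^*$-algebra $M$ whose identity $e_M$ is a multiplicative linear functional on $A$. It is *left amenable* if for each Banach $A$-bimodule $X$ with left action $a\cdot x=\langle a,e_M\rangle x$ every bounded derivation $D:A\to X^*$ is inner, i.e. of the form $D(a)=a\cdot f-f\cdot a$ for some $f\in X^*$, where $(a\cdot f)(x)=f(x\cdot a)$ and $(f\cdot a)(x)=f(a\cdot x)$. The algebra $M(K)$ is an F-algebra: $M(K)^*$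 is a W$^*$-algebra with identity $\mathbb 1$, and $(\mu*\nu)(K)=\mu(K)\nu(K)$. **Theorem.** Let $K$ be a semitopological semihypergroup. The following are equivalent: 1. $K$ admits a TLIM. 2. There is a net $(\nu_\alpha)$ in $P(K)$ such that $\|\nu*\nu_\alpha-\nu_\alpha\|\to0$ for every $\nu\in P(K)$. 3. $|\mu(K)|=\inf\{\|\mu*\nu\|:\nu\in P(K)\}$ for every $\mu\in M(K)$. 4. $K$ is topological right stationary. 5. $M(K)$ is left amenable as an F-algebra. -/

import Mathlib

open MeasureTheory Filter Topology TopologicalSpace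

universe u

namespace SemiHyp

open scoped ENNReal NNReal ComplexOrder

noncomputable section

/-! ### Regular complex Borel measures and the total variation norm -/

theorem finite_variation {X : Type u} [MeasurableSpace X] (c : ComplexMeasure X) :
    IsFiniteMeasure c.variation := by
  have h : c.variation ≤ (ComplexMeasure.re c).totalVariation
      + (ComplexMeasure.im c).totalVariation := by
    refine VectorMeasure.variation_le_of_forall_enorm_le fun E _ => ?_
    have h1 : ‖c E‖ₑ ≤ ‖(c E).re‖ₑ + ‖(c E).im‖ₑ := by
      have h0 : c E = ((c E).re : ℂ) + ((c E).im : ℂ) * Complex.I := (Complex.re_add_im _).symm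
      calc ‖c E‖ₑ = ‖((c E).re : ℂ) + ((c E).im : ℂ) * Complex.I‖ₑ := by rw [← h0]
        _ ≤ ‖((c E).re : ℂ)‖ₑ + ‖((c E).im : ℂ) * Complex.I‖ₑ := enorm_add_le _ _
        _ = _ := by simp [enorm_eq_nnnorm]
    refine h1.trans (add_le_add ?_ ?_)
    · exact SignedMeasure.enorm_le_totalVariation (ComplexMeasure.re c) E
    · exact SignedMeasure.enorm_le_totalVariation (ComplexMeasure.im c) E
  refine ⟨(h Set.univ).trans_lt ?_⟩
  exact measure_lt_top _ _

attribute [instance] finite_variation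

theorem regular_of_le {X : Type u} [TopologicalSpace X] [T2Space X] [MeasurableSpace X]
    [BorelSpace X] {μ ν : Measure X} [IsFiniteMeasure ν] (h : μ ≤ ν) (hν : ν.Regular) :
    μ.Regular := by
  have : IsFiniteMeasure μ := ⟨(h Set.univ).trans_lt (measure_lt_top ν _)⟩
  have : μ.InnerRegularCompactLTTop := by
    refine ⟨fun E hE r hr => ?_⟩
    obtain ⟨C, hCE, hC, hlt⟩ := hE.1.exists_isCompact_sdiff_lt (measure_ne_top ν E)
      (tsub_pos_of_lt hr).ne'
    refine ⟨C, hCE, hC, ?_⟩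
    have h1 : μ E ≤ μ C + μ (E \ C) := by
      rw [add_comm]
      calc μ E ≤ μ ((E \ C) ∪ C) := measure_mono (by intro x hx; by_cases hxC : x ∈ C <;> simp [*])
        _ ≤ _ := measure_union_le _ _
    have h2 : μ (E \ C) < μ E - r := (h _).trans_lt hlt
    by_contra hcon
    push Not at hcon
    have h3 : μ E < r + (μ E - r) :=
      h1.trans_lt (ENNReal.add_lt_add_of_le_of_lt (measure_ne_top μ C) hcon h2)
    rw [add_tsub_cancel_of_le hr.le] at h3
    exact lt_irrefl _ h3
  infer_instance

theorem regular_add {X : Type u} [TopologicalSpace X] [T2Space X] [MeasurableSpace X]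
    [BorelSpace X] {μ ν : Measure X} [IsFiniteMeasure μ] [IsFiniteMeasure ν]
    (hμ : μ.Regular) (hν : ν.Regular) : (μ + ν).Regular := by
  infer_instance

variable (K : Type u) [TopologicalSpace K] [T2Space K] [MeasurableSpace K] [BorelSpace K]

/-- The regular complex Borel measures as a subspace of all complex Borel measures: `μ` is
regular if its total variation measure `|μ|` is regular. -/
def regularSubmodule : Submodule ℂ (ComplexMeasure K) where
  carrier := {μ | μ.variation.Regular}
  zero_mem' := by
    simp only [Set.mem_ofPred_eq, VectorMeasure.variation_zero]
    infer_instance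
  add_mem' := fun {μ ν} hμ hν =>
    regular_of_le VectorMeasure.variation_add_le (regular_add hμ hν)
  smul_mem' := fun c μ hμ => by
    have h : μ.variation.Regular := hμ
    simp only [Set.mem_ofPred_eq, VectorMeasure.variation_smul]
    infer_instance

/-- `M(K)`: the space of all regular complex Borel measures on `K`. -/
def RegMeas : Type u := regularSubmodule K

instance : AddCommGroup (RegMeas K) := inferInstanceAs (AddCommGroup (regularSubmodule K))

instance : Module ℂ (RegMeas K) := inferInstanceAs (Module ℂ (regularSubmodule K))

variable {K}

namespace RegMeas

/-- The underlying complex measure. -/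
def toComplex (μ : RegMeas K) : ComplexMeasure K := μ.1

/-- The total variation measure `|μ|`. -/
def abs (μ : RegMeas K) : Measure K := μ.toComplex.variation

/-- The value `μ(E)`. -/
instance : CoeFun (RegMeas K) (fun _ => Set K → ℂ) := ⟨fun μ => μ.toComplex⟩

instance (μ : RegMeas K) : IsFiniteMeasure μ.abs := finite_variation μ.toComplex

instance (μ : RegMeas K) : μ.abs.Regular := μ.2

theorem ext {μ ν : RegMeas K} (h : ∀ E, MeasurableSet E → μ E = ν E) : μ = ν :=
  Subtype.ext (VectorMeasure.ext h)

@[simp] theorem add_apply (μ ν : RegMeas K) (E : Set K) : (μ + ν) E = μ E + ν E := rfl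

@[simp] theorem smul_apply (c : ℂ) (μ : RegMeas K) (E : Set K) : (c • μ) E = c * μ E := rfl

@[simp] theorem zero_apply (E : Set K) : (0 : RegMeas K) E = 0 := rfl

@[simp] theorem sub_apply (μ ν : RegMeas K) (E : Set K) : (μ - ν) E = μ E - ν E := rfl

theorem not_measurable (μ : RegMeas K) {E : Set K} (hE : ¬ MeasurableSet E) : μ E = 0 :=
  μ.toComplex.not_measurable hE

/-- The total variation norm `‖μ‖ = |μ|(K)`. -/
instance : Norm (RegMeas K) := ⟨fun μ => μ.abs.real Set.univ⟩

theorem norm_def (μ : RegMeas K) : ‖μ‖ = μ.abs.real Set.univ := rfl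

theorem norm_apply_le_abs (μ : RegMeas K) (E : Set K) : ‖μ E‖ ≤ μ.abs.real E :=
  VectorMeasure.norm_measure_le_variation (measure_ne_top μ.abs E)

theorem norm_apply_le (μ : RegMeas K) (E : Set K) : ‖μ E‖ ≤ ‖μ‖ :=
  (norm_apply_le_abs μ E).trans (measureReal_mono (Set.subset_univ E))

theorem normCore : NormedSpace.Core ℂ (RegMeas K) where
  norm_nonneg μ := measureReal_nonneg
  norm_smul c μ := by
    simp only [norm_def, abs]
    have h : (c • μ).toComplex.variation = ‖c‖₊ • μ.toComplex.variation :=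
      VectorMeasure.variation_smul (μ := μ.toComplex) (c := c)
    rw [h, measureReal_nnreal_smul_apply]
    rfl
  norm_triangle μ ν := by
    have h : (μ + ν).abs ≤ μ.abs + ν.abs :=
      VectorMeasure.variation_add_le (μ := μ.toComplex) (ν := ν.toComplex)
    simp only [norm_def]
    rw [← measureReal_add_apply]
    exact ENNReal.toReal_mono (measure_ne_top _ _) (h _)
  norm_eq_zero_iff μ := by
    constructor
    · intro h
      refine ext fun E _ => ?_
      have := norm_apply_le μ E
      rw [h] at this
      simpa using this
    · rintro rfl
      have h : (0 : RegMeas K).abs = 0 := VectorMeasure.variation_zero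
      simp [norm_def, h]

instance : NormedAddCommGroup (RegMeas K) := NormedAddCommGroup.ofCore normCore

instance : NormedSpace ℂ (RegMeas K) := NormedSpace.ofCore normCore

/-- The point mass `p_x`. -/
def pointMass (x : K) : RegMeas K :=
  ⟨VectorMeasure.dirac x 1, by
    change Measure.Regular _
    rw [VectorMeasure.variation_dirac, enorm_one, one_smul]
    have : (Measure.dirac x).InnerRegularCompactLTTop := by
      refine ⟨fun E hE r hr => ?_⟩
      by_cases hx : x ∈ E
      · refine ⟨{x}, by simpa using hx, isCompact_singleton, hr.trans_le ?_⟩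
        simpa using prob_le_one (μ := Measure.dirac x) (s := E)
      · rw [Measure.dirac_apply' x hE.1] at hr
        simp [hx] at hr
    infer_instance⟩

end RegMeas

variable (K)

/-- `M⁺(K)`: the finite non-negative regular Borel measures. -/
def posMeas : Set (RegMeas K) := {μ | ∀ E : Set K, 0 ≤ μ E}

/-- `P(K)`: the regular Borel probability measures. -/
def probMeas : Set (RegMeas K) := {μ | μ ∈ posMeas K ∧ μ Set.univ = 1}

variable {K}

/-- For `μ ∈ M⁺(K)` the measure `|μ|` is `μ` itself. -/
theorem abs_apply_of_pos {μ : RegMeas K} (hμ : μ ∈ posMeas K) {E : Set K} (hE : MeasurableSet E) :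
    μ.abs E = ENNReal.ofReal (μ E).re := by
  have hpos : ∀ F : Set K, 0 ≤ (μ F).re := fun F => (Complex.le_def.1 (hμ F)).1
  have him : ∀ F : Set K, (μ F).im = 0 := fun F => ((Complex.le_def.1 (hμ F)).2).symm
  have hen : ∀ F : Set K, ‖μ F‖ₑ = ENNReal.ofReal (μ F).re := by
    intro F
    have : μ F = (((μ F).re : ℝ) : ℂ) := Complex.ext rfl (by simp [him])
    rw [this, ← ofReal_norm, Complex.norm_of_nonneg (hpos F)]
    simp
  have hz : VectorMeasure.restrict 0 Set.univ ≤
      VectorMeasure.restrict (ComplexMeasure.re μ.toComplex) Set.univ := by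
    rw [VectorMeasure.restrict_univ, VectorMeasure.restrict_univ]
    intro F _
    exact hpos F
  set m := SignedMeasure.toMeasureOfZeroLE (ComplexMeasure.re μ.toComplex) Set.univ
    MeasurableSet.univ hz with hm
  have hmE : ∀ F, MeasurableSet F → m F = ENNReal.ofReal (μ F).re := by
    intro F hF
    rw [hm, SignedMeasure.toMeasureOfZeroLE_apply _ hz MeasurableSet.univ hF,
      ENNReal.ofReal_eq_coe_nnreal (hpos F)]
    congr 1
    apply NNReal.eq
    simp only [Set.univ_inter]
    rfl
  apply le_antisymm
  · rw [← hmE E hE]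
    exact VectorMeasure.variation_le_of_forall_enorm_le
      (fun F hF => by rw [hmE F hF]; exact (hen F).le) E
  · rw [← hen]
    exact VectorMeasure.enorm_measure_le_variation _ _

theorem abs_real_of_pos {μ : RegMeas K} (hμ : μ ∈ posMeas K) {E : Set K} (hE : MeasurableSet E) :
    ((μ.abs.real E : ℝ) : ℂ) = μ E := by
  have hpos : 0 ≤ (μ E).re := (Complex.le_def.1 (hμ E)).1
  have him : (μ E).im = 0 := ((Complex.le_def.1 (hμ E)).2).symm
  rw [measureReal_def, abs_apply_of_pos hμ hE, ENNReal.toReal_ofReal hpos]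
  exact Complex.ext rfl (by simp [him])

theorem norm_of_pos {μ : RegMeas K} (hμ : μ ∈ posMeas K) : ((‖μ‖ : ℝ) : ℂ) = μ Set.univ :=
  abs_real_of_pos hμ MeasurableSet.univ

theorem posMeas_add {μ ν : RegMeas K} (hμ : μ ∈ posMeas K) (hν : ν ∈ posMeas K) :
    μ + ν ∈ posMeas K := fun E => add_nonneg (hμ E) (hν E)

theorem posMeas_smul {μ : RegMeas K} (hμ : μ ∈ posMeas K) {c : ℂ} (hc : 0 ≤ c) :
    c • μ ∈ posMeas K := fun E => mul_nonneg hc (hμ E)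

theorem pointMass_mem (x : K) : RegMeas.pointMass x ∈ probMeas K := by
  classical
  constructor
  · intro E
    change 0 ≤ VectorMeasure.dirac x (1 : ℂ) E
    by_cases hE : MeasurableSet E
    · by_cases hx : x ∈ E
      · rw [VectorMeasure.dirac_apply_of_mem hE hx]; exact zero_le_one
      · rw [VectorMeasure.dirac_apply_of_notMem hx]
    · rw [VectorMeasure.not_measurable _ hE]
  · exact VectorMeasure.dirac_apply_of_mem MeasurableSet.univ (Set.mem_univ x)

/-! ### Measures with a density -/

theorem regular_withDensity {ρ : Measure K} [IsFiniteMeasure ρ] [ρ.Regular] {f : K → ℝ≥0∞}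
    (hf : ∫⁻ x, f x ∂ρ ≠ ∞) : (ρ.withDensity f).Regular := by
  have hfin : IsFiniteMeasure (ρ.withDensity f) := isFiniteMeasure_withDensity hf
  have : (ρ.withDensity f).InnerRegularCompactLTTop := by
    refine ⟨fun E hE r hr => ?_⟩
    obtain ⟨δ, hδ, h⟩ := exists_pos_setLIntegral_lt_of_measure_lt hf (tsub_pos_of_lt hr).ne'
    obtain ⟨C, hCE, hC, hlt⟩ := hE.1.exists_isCompact_sdiff_lt (measure_ne_top ρ E) hδ.ne'
    refine ⟨C, hCE, hC, ?_⟩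
    have h2 := h _ hlt
    rw [← withDensity_apply _ (hE.1.diff hC.measurableSet)] at h2
    have h1 : ρ.withDensity f E ≤ ρ.withDensity f C + ρ.withDensity f (E \ C) := by
      rw [add_comm]
      calc ρ.withDensity f E ≤ ρ.withDensity f ((E \ C) ∪ C) :=
            measure_mono (by intro x hx; by_cases hxC : x ∈ C <;> simp [*])
        _ ≤ _ := measure_union_le _ _
    by_contra hcon
    push Not at hcon
    have h3 := h1.trans_lt (ENNReal.add_lt_add_of_le_of_lt (measure_ne_top _ C) hcon h2)
    rw [add_tsub_cancel_of_le hr.le] at h3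
    exact lt_irrefl _ h3
  infer_instance

/-- The measure `E ↦ ∫_E f dρ` (zero if `f` is not integrable). -/
def dens (ρ : Measure K) [IsFiniteMeasure ρ] [ρ.Regular] (f : K → ℂ) : RegMeas K :=
  ⟨ρ.withDensityᵥ f, by
    change Measure.Regular _
    by_cases hf : Integrable f ρ
    · rw [Measure.variation_withDensityᵥ hf]
      exact regular_withDensity hf.2.ne
    · rw [Measure.withDensityᵥ, dif_neg hf, VectorMeasure.variation_zero]
      infer_instance⟩

section dens

variable {ρ : Measure K} [IsFiniteMeasure ρ] [ρ.Regular]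

theorem dens_apply {f : K → ℂ} (hf : Integrable f ρ) {E : Set K} (hE : MeasurableSet E) :
    dens ρ f E = ∫ x in E, f x ∂ρ := withDensityᵥ_apply hf hE

theorem dens_abs {f : K → ℂ} (hf : Integrable f ρ) :
    (dens ρ f).abs = ρ.withDensity (fun x => ‖f x‖ₑ) := Measure.variation_withDensityᵥ hf

theorem dens_norm {f : K → ℂ} (hf : Integrable f ρ) : ‖dens ρ f‖ = ∫ x, ‖f x‖ ∂ρ := by
  rw [RegMeas.norm_def, dens_abs hf, measureReal_def, withDensity_apply _ MeasurableSet.univ,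
    Measure.restrict_univ, integral_norm_eq_lintegral_enorm hf.1]

theorem dens_add {f g : K → ℂ} (hf : Integrable f ρ) (hg : Integrable g ρ) :
    dens ρ (f + g) = dens ρ f + dens ρ g :=
  Subtype.ext (withDensityᵥ_add hf hg)

theorem dens_smul (c : ℂ) (f : K → ℂ) : dens ρ (c • f) = c • dens ρ f :=
  Subtype.ext (withDensityᵥ_smul f c)

theorem dens_congr {f g : K → ℂ} (h : f =ᵐ[ρ] g) : dens ρ f = dens ρ g :=
  Subtype.ext (WithDensityᵥEq.congr_ae h)

theorem dens_pos {f : K → ℂ} (hf : Integrable f ρ) (h : ∀ x, 0 ≤ f x) : dens ρ f ∈ posMeas K := by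
  intro E
  by_cases hE : MeasurableSet E
  · rw [dens_apply hf hE]
    have : ∀ x, f x = (((f x).re : ℝ) : ℂ) := fun x =>
      Complex.ext rfl (by simp [((Complex.le_def.1 (h x)).2).symm])
    rw [integral_congr_ae (Eventually.of_forall this), integral_complex_ofReal]
    exact_mod_cast integral_nonneg fun x => (Complex.le_def.1 (h x)).1
  · rw [RegMeas.not_measurable _ hE]

/-- The isometric embedding `L¹(ρ) → M(K)`. -/
def densL (ρ : Measure K) [IsFiniteMeasure ρ] [ρ.Regular] : (K →₁[ρ] ℂ) →ₗᵢ[ℂ] RegMeas K where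
  toFun f := dens ρ f
  map_add' f g := by
    rw [dens_congr (Lp.coeFn_add f g), dens_add (L1.integrable_coeFn f) (L1.integrable_coeFn g)]
  map_smul' c f := by
    rw [dens_congr (Lp.coeFn_smul c f), dens_smul]; rfl
  norm_map' f := by
    change ‖dens ρ f‖ = _
    rw [dens_norm (L1.integrable_coeFn f), L1.norm_eq_integral_norm]

/-- Radon-Nikodym for `M(K)`. -/
theorem exists_dens {μ : RegMeas K} (h : μ.abs ≪ ρ) :
    ∃ f : K → ℂ, Measurable f ∧ Integrable f ρ ∧ μ = dens ρ f := by
  have hac : ∀ E : Set K, MeasurableSet E → ρ E = 0 → μ E = 0 := by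
    intro E _ h0
    have h1 := RegMeas.norm_apply_le_abs μ E
    rw [measureReal_def, h h0] at h1
    simpa using h1
  have hre : (ComplexMeasure.re μ.toComplex) ≪ᵥ ρ.toENNRealVectorMeasure := by
    refine VectorMeasure.AbsolutelyContinuous.mk fun E hE h0 => ?_
    rw [Measure.toENNRealVectorMeasure_apply_measurable hE] at h0
    change (μ E).re = 0
    rw [hac E hE h0, Complex.zero_re]
  have him : (ComplexMeasure.im μ.toComplex) ≪ᵥ ρ.toENNRealVectorMeasure := by
    refine VectorMeasure.AbsolutelyContinuous.mk fun E hE h0 => ?_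
    rw [Measure.toENNRealVectorMeasure_apply_measurable hE] at h0
    change (μ E).im = 0
    rw [hac E hE h0, Complex.zero_im]
  have hre' := (SignedMeasure.absolutelyContinuous_iff_withDensityᵥ_rnDeriv_eq _ _).1 hre
  have him' := (SignedMeasure.absolutelyContinuous_iff_withDensityᵥ_rnDeriv_eq _ _).1 him
  have hint : Integrable (ComplexMeasure.rnDeriv μ.toComplex ρ) ρ :=
    ComplexMeasure.integrable_rnDeriv _ _
  refine ⟨ComplexMeasure.rnDeriv μ.toComplex ρ, ?_, hint, ?_⟩
  · have : ComplexMeasure.rnDeriv μ.toComplex ρ = fun x =>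
        (((ComplexMeasure.re μ.toComplex).rnDeriv ρ x : ℝ) : ℂ) +
        (((ComplexMeasure.im μ.toComplex).rnDeriv ρ x : ℝ) : ℂ) * Complex.I := by
      funext x
      exact (Complex.re_add_im _).symm
    rw [this]
    exact (Complex.measurable_ofReal.comp (SignedMeasure.measurable_rnDeriv _ _)).add
      ((Complex.measurable_ofReal.comp (SignedMeasure.measurable_rnDeriv _ _)).mul_const _)
  · refine RegMeas.ext fun E hE => ?_
    rw [dens_apply hint hE]
    apply Complex.ext
    · rw [← RCLike.re_eq_complex_re, ← integral_re hint.integrableOn]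
      have h1 := congrArg (fun s : SignedMeasure K => s E) hre'
      rw [withDensityᵥ_apply (SignedMeasure.integrable_rnDeriv _ _) hE] at h1
      exact h1.symm
    · rw [← RCLike.im_eq_complex_im, ← integral_im hint.integrableOn]
      have h1 := congrArg (fun s : SignedMeasure K => s E) him'
      rw [withDensityᵥ_apply (SignedMeasure.integrable_rnDeriv _ _) hE] at h1
      exact h1.symm

/-- Polar decomposition in `M(K)`. -/
theorem exists_polar (μ : RegMeas K) :
    ∃ f : K → ℂ, Measurable f ∧ (∀ x, ‖f x‖ = 1) ∧ Integrable f μ.abs ∧ μ = dens μ.abs f := by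
  obtain ⟨f, hf, hfi, h⟩ := exists_dens (μ := μ) (ρ := μ.abs) Measure.AbsolutelyContinuous.rfl
  have h1 : (fun x => ‖f x‖ₑ) =ᵐ[μ.abs] fun _ => 1 := by
    refine (withDensity_eq_iff_of_sigmaFinite hf.enorm.aemeasurable aemeasurable_const).1 ?_
    rw [← dens_abs hfi, ← h, withDensity_const, one_smul]
  have hS : MeasurableSet {x | ‖f x‖ = 1} := hf.norm (measurableSet_singleton 1)
  classical
  set g : K → ℂ := fun x => if ‖f x‖ = 1 then f x else 1 with hg
  have hfg : f =ᵐ[μ.abs] g := by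
    filter_upwards [h1] with x hx
    have : ‖f x‖ = 1 := by
      rw [← toReal_enorm, hx, ENNReal.toReal_one]
    simp [hg, this]
  refine ⟨g, Measurable.ite hS hf measurable_const, fun x => ?_, hfi.congr hfg, ?_⟩
  · by_cases hx : ‖f x‖ = 1 <;> simp [hg, hx]
  · rw [← dens_congr hfg]; exact h

end dens

/-! ### The cone topology, the Michael topology and semitopological semihypergroups -/

variable (K)

/-- The test functions `C_c⁺(K) ∪ {1_K}` of the cone topology. -/
def coneTests : Set (K → ℝ) :=
  {f | Continuous f ∧ HasCompactSupport f ∧ ∀ x, 0 ≤ f x} ∪ {fun _ => 1}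

/-- The cone topology on `M⁺(K)`: the weakest topology for which `μ ↦ ∫ f dμ` is continuous for
every `f ∈ C_c⁺(K) ∪ {1_K}`. -/
@[reducible] def coneTopology : TopologicalSpace (posMeas K) :=
  ⨅ f ∈ coneTests K, TopologicalSpace.induced
    (fun μ : posMeas K => ∫ x, f x ∂(μ : RegMeas K).abs) inferInstance

/-- The Michael topology on the compact subsets of `K`, generated by the sets
`{C | C ∩ U ≠ ∅, C ⊆ V}` with `U, V` open. -/
@[reducible] def michaelTopology : TopologicalSpace (Compacts K) :=
  TopologicalSpace.generateFrom
    {S | ∃ U V : Set K, IsOpen U ∧ IsOpen V ∧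
      S = {C : Compacts K | ((C : Set K) ∩ U).Nonempty ∧ (C : Set K) ⊆ V}}

/-- A semitopological semihypergroup: a locally compact Hausdorff space `K` with a convolution `*`
that makes `M(K)` an associative algebra, such that `*` is positive and separately continuous on
`M⁺(K)` (cone topology), `p_x * p_y` is a probability measure with compact support, and
`(x, y) ↦ supp (p_x * p_y)` is separately continuous (Michael topology). -/
class SemitopologicalSemihypergroup [LocallyCompactSpace K] where
  conv : RegMeas K →ₗ[ℂ] RegMeas K →ₗ[ℂ] RegMeas K
  conv_assoc : ∀ μ ν ω : RegMeas K, conv (conv μ ν) ω = conv μ (conv ν ω)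
  conv_pos : ∀ μ ∈ posMeas K, ∀ ν ∈ posMeas K, conv μ ν ∈ posMeas K
  continuous_conv_left : ∀ ν : posMeas K, Continuous[coneTopology K, coneTopology K]
    (fun μ : posMeas K => (⟨conv μ ν, conv_pos μ μ.2 ν ν.2⟩ : posMeas K))
  continuous_conv_right : ∀ μ : posMeas K, Continuous[coneTopology K, coneTopology K]
    (fun ν : posMeas K => (⟨conv μ ν, conv_pos μ μ.2 ν ν.2⟩ : posMeas K))
  conv_pointMass_mem : ∀ x y : K,
    conv (RegMeas.pointMass x) (RegMeas.pointMass y) ∈ probMeas K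
  isCompact_support : ∀ x y : K,
    IsCompact (conv (RegMeas.pointMass x) (RegMeas.pointMass y)).abs.support
  continuous_support_left : ∀ y : K, @Continuous K (Compacts K) _ (michaelTopology K)
    (fun x : K => (⟨(conv (RegMeas.pointMass x) (RegMeas.pointMass y)).abs.support,
      isCompact_support x y⟩ : Compacts K))
  continuous_support_right : ∀ x : K, @Continuous K (Compacts K) _ (michaelTopology K)
    (fun y : K => (⟨(conv (RegMeas.pointMass x) (RegMeas.pointMass y)).abs.support,
      isCompact_support x y⟩ : Compacts K))

variable {K}

/-! ### Finitely supported measures are dense in the cone topology -/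

theorem abs_add_of_pos {μ ν : RegMeas K} (hμ : μ ∈ posMeas K) (hν : ν ∈ posMeas K) :
    (μ + ν).abs = μ.abs + ν.abs := by
  ext E hE
  rw [Measure.add_apply, abs_apply_of_pos (posMeas_add hμ hν) hE, abs_apply_of_pos hμ hE,
    abs_apply_of_pos hν hE, RegMeas.add_apply, Complex.add_re, ENNReal.ofReal_add]
  · exact (Complex.le_def.1 (hμ E)).1
  · exact (Complex.le_def.1 (hν E)).1

theorem abs_pointMass (x : K) : (RegMeas.pointMass x).abs = Measure.dirac x := by
  change (VectorMeasure.dirac x (1 : ℂ)).variation = _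
  rw [VectorMeasure.variation_dirac, enorm_one, one_smul]

theorem measAbs_smul (c : ℂ) (μ : RegMeas K) : (c • μ).abs = ‖c‖₊ • μ.abs :=
  VectorMeasure.variation_smul (μ := μ.toComplex) (c := c)

theorem measAbs_zero : (0 : RegMeas K).abs = 0 := VectorMeasure.variation_zero

theorem coneTests_bounded {f : K → ℝ} (hf : f ∈ coneTests K) :
    Continuous f ∧ ∃ C, ∀ x, |f x| ≤ C := by
  rcases hf with ⟨h1, h2, _⟩ | h
  · refine ⟨h1, ?_⟩
    obtain ⟨C, hC⟩ := h2.exists_bound_of_continuous h1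
    exact ⟨C, fun x => by simpa using hC x⟩
  · have h' : f = fun _ => 1 := h
    subst h'
    exact ⟨continuous_const, 1, fun x => by simp⟩

/-- Positive combination of point masses attached to a finite-valued map. -/
theorem exists_finite_approx (μ : RegMeas K) (T : K → K) (hT : Set.Finite (Set.range T))
    (hTm : ∀ y, MeasurableSet (T ⁻¹' {y})) :
    ∃ ν : RegMeas K, ν ∈ posMeas K ∧
      ν ∈ Submodule.span ℂ (Set.range (RegMeas.pointMass : K → RegMeas K)) ∧
      ∀ f : K → ℝ, Measurable f → (∃ C, ∀ x, |f x| ≤ C) →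
        ∫ x, f x ∂ν.abs = ∫ x, f (T x) ∂μ.abs := by
  classical
  set s : Finset K := hT.toFinset with hs
  have hmem : ∀ t : Finset K,
      (∑ y ∈ t, ((μ.abs.real (T ⁻¹' {y}) : ℝ) : ℂ) • RegMeas.pointMass y) ∈ posMeas K ∧
      (∑ y ∈ t, ((μ.abs.real (T ⁻¹' {y}) : ℝ) : ℂ) • RegMeas.pointMass y) ∈
        Submodule.span ℂ (Set.range (RegMeas.pointMass : K → RegMeas K)) ∧
      ∀ f : K → ℝ, Measurable f → (∃ C, ∀ x, |f x| ≤ C) →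
        ∫ x, f x ∂(∑ y ∈ t, ((μ.abs.real (T ⁻¹' {y}) : ℝ) : ℂ) • RegMeas.pointMass y).abs =
          ∑ y ∈ t, μ.abs.real (T ⁻¹' {y}) * f y := by
    intro t
    induction t using Finset.induction_on with
    | empty =>
      refine ⟨fun E => by simp, by simp, fun f _ _ => ?_⟩
      simp [measAbs_zero]
    | insert a t ha ih =>
      obtain ⟨h1, h2, h3⟩ := ih
      have hp : ((μ.abs.real (T ⁻¹' {a}) : ℝ) : ℂ) • RegMeas.pointMass a ∈ posMeas K :=
        posMeas_smul (pointMass_mem a).1 (by exact_mod_cast measureReal_nonneg)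
      simp only [Finset.sum_insert ha]
      refine ⟨posMeas_add hp h1, Submodule.add_mem _
        (Submodule.smul_mem _ _ (Submodule.subset_span ⟨a, rfl⟩)) h2, fun f hf hb => ?_⟩
      obtain ⟨C, hC⟩ := hb
      have hint : ∀ m : Measure K, IsFiniteMeasure m → Integrable f m := fun m _ =>
        Integrable.of_bound hf.aestronglyMeasurable C (Eventually.of_forall hC)
      rw [abs_add_of_pos hp h1, integral_add_measure (hint _ inferInstance) (hint _ inferInstance),
        h3 f hf ⟨C, hC⟩, measAbs_smul, abs_pointMass, integral_smul_nnreal_measure,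
        integral_dirac' _ _ hf.stronglyMeasurable]
      congr 1
      rw [NNReal.smul_def, coe_nnnorm, Complex.norm_of_nonneg measureReal_nonneg, smul_eq_mul]
  obtain ⟨h1, h2, h3⟩ := hmem s
  refine ⟨_, h1, h2, fun f hf hb => ?_⟩
  rw [h3 f hf hb]
  have hfin : ∀ x, f (T x) = ∑ y ∈ s, (T ⁻¹' {y}).indicator (fun _ => f y) x := by
    intro x
    rw [Finset.sum_eq_single (T x)]
    · simp
    · intro y _ hy
      rw [Set.indicator_of_notMem]
      intro h
      exact hy h.symm
    · intro h
      exact absurd (by rw [hs, Set.Finite.mem_toFinset]; exact ⟨x, rfl⟩) h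
  simp_rw [hfin]
  rw [integral_finsetSum]
  · refine Finset.sum_congr rfl fun y _ => ?_
    rw [integral_indicator (hTm y), setIntegral_const, smul_eq_mul]
  · intro y _
    exact (integrable_const _).indicator (hTm y)

theorem exists_retraction (I : Finset (K → ℝ)) (hI : ∀ f ∈ I, f ∈ coneTests K) {ε : ℝ}
    (hε : 0 < ε) : ∃ T : K → K, Set.Finite (Set.range T) ∧ (∀ y, MeasurableSet (T ⁻¹' {y})) ∧
      ∀ f ∈ I, ∀ x, |f (T x) - f x| ≤ ε := by
  classical
  rcases isEmpty_or_nonempty K with hK | hK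
  · exact ⟨id, Set.toFinite _, fun y => isEmptyElim y, fun f _ x => isEmptyElim x⟩
  let Ψ : K → (I → ℤ) := fun x f => ⌊f.1 x / ε⌋
  have hΨm : ∀ c : I → ℤ, MeasurableSet (Ψ ⁻¹' {c}) := by
    intro c
    have : Ψ ⁻¹' {c} = ⋂ f : I, (fun x => ⌊f.1 x / ε⌋) ⁻¹' {c f} := by
      ext x
      simp [Ψ, funext_iff]
    rw [this]
    refine MeasurableSet.iInter fun f => ?_
    exact (Int.measurable_floor.comp
      ((coneTests_bounded (hI f.1 f.2)).1.measurable.div_const ε)) (measurableSet_singleton _)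
  have hfin : (Set.range Ψ).Finite := by
    choose! C hC using fun f (hf : f ∈ I) => (coneTests_bounded (hI f hf)).2
    refine (Set.Finite.pi' (t := fun f : I => Set.Icc (⌊-(C f.1) / ε⌋) ⌊C f.1 / ε⌋)
      (fun f => Set.finite_Icc _ _)).subset ?_
    rintro _ ⟨x, rfl⟩ f
    have := abs_le.1 (hC f.1 f.2 x)
    constructor
    · exact Int.floor_le_floor (by gcongr; exact this.1)
    · exact Int.floor_le_floor (by gcongr; exact this.2)
  let r : (I → ℤ) → K := Function.invFun Ψ
  have hr : ∀ x, Ψ (r (Ψ x)) = Ψ x := fun x => Function.invFun_eq ⟨x, rfl⟩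
  refine ⟨fun x => r (Ψ x), ?_, fun y => ?_, fun f hf x => ?_⟩
  · have : Set.range (fun x => r (Ψ x)) = r '' Set.range Ψ := by
      rw [← Set.range_comp]; rfl
    rw [this]
    exact hfin.image r
  · have : (fun x => r (Ψ x)) ⁻¹' {y} = ⋃ c ∈ {c ∈ Set.range Ψ | r c = y}, Ψ ⁻¹' {c} := by
      ext x
      simp
    rw [this]
    exact MeasurableSet.biUnion ((hfin.subset (Set.sep_subset _ _)).countable)
      fun c _ => hΨm c
  · have h := congrFun (hr x) ⟨f, hf⟩
    simp only [Ψ] at h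
    have h2 := Int.abs_sub_lt_one_of_floor_eq_floor h
    rw [← sub_div, abs_div, abs_of_pos hε, div_lt_one hε] at h2
    exact h2.le

/-- A cone-continuous function that vanishes on the finitely supported measures vanishes. -/
theorem eq_of_eq_on_finite {F G : posMeas K → ℝ}
    (hF : Continuous[coneTopology K, inferInstance] F)
    (hG : Continuous[coneTopology K, inferInstance] G)
    (h : ∀ μ : posMeas K, (μ : RegMeas K) ∈
      Submodule.span ℂ (Set.range (RegMeas.pointMass : K → RegMeas K)) → F μ = G μ) :
    F = G := by
  classical
  let τ : TopologicalSpace (posMeas K) := coneTopology K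
  funext μ
  by_contra hne
  have hopen : IsOpen[τ] {ν | F ν ≠ G ν} := by
    exact @isOpen_ne_fun _ _ _ τ _ _ _ hF hG
  let Φ : posMeas K → (coneTests K → ℝ) := fun ν f => ∫ x, f.1 x ∂(ν : RegMeas K).abs
  have hτ : τ = TopologicalSpace.induced Φ inferInstance := by
    have h1 : τ = ⨅ f : coneTests K, TopologicalSpace.induced
        (fun ν : posMeas K => ∫ x, f.1 x ∂(ν : RegMeas K).abs) inferInstance := by
      change coneTopology K = _
      rw [coneTopology, iInf_subtype']
    rw [h1]
    exact (induced_to_pi Φ).symm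
  rw [hτ] at hopen
  obtain ⟨V, hV, hVeq⟩ := isOpen_induced_iff.1 hopen
  have hμV : Φ μ ∈ V := by
    have : μ ∈ Φ ⁻¹' V := by rw [hVeq]; exact hne
    exact this
  obtain ⟨I, ε, hε, hsub⟩ : ∃ (I : Finset (coneTests K)) (ε : ℝ), 0 < ε ∧
      ∀ z : coneTests K → ℝ, (∀ f ∈ I, |z f - Φ μ f| ≤ ε) → z ∈ V := by
    obtain ⟨I, u, hu, hsub⟩ := isOpen_pi_iff.1 hV (Φ μ) hμV
    have : ∀ f ∈ I, ∃ ε > 0, Metric.closedBall (Φ μ f) ε ⊆ u f := fun f hf =>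
      Metric.nhds_basis_closedBall.mem_iff.1 ((hu f hf).1.mem_nhds (hu f hf).2)
    choose! e he hball using this
    rcases I.eq_empty_or_nonempty with rfl | hne
    · exact ⟨∅, 1, one_pos, fun z _ => hsub (by simp)⟩
    · refine ⟨I, I.inf' hne e, (Finset.lt_inf'_iff hne).2 he, fun z hz => hsub ?_⟩
      intro f hf
      apply hball f hf
      rw [Metric.mem_closedBall, Real.dist_eq]
      exact (hz f hf).trans (Finset.inf'_le _ hf)
  set m := ‖(μ : RegMeas K)‖ with hm
  have hm0 : 0 ≤ m := norm_nonneg _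
  obtain ⟨T, hT1, hT2, hT3⟩ := exists_retraction (I.image Subtype.val)
    (by intro f hf; obtain ⟨g, _, rfl⟩ := Finset.mem_image.1 hf; exact g.2)
    (show 0 < ε / (m + 1) by positivity)
  obtain ⟨ν, hν1, hν2, hν3⟩ := exists_finite_approx (μ : RegMeas K) T hT1 hT2
  have hνV : Φ ⟨ν, hν1⟩ ∈ V := by
    apply hsub
    intro f hf
    obtain ⟨hc, C, hC⟩ := coneTests_bounded f.2
    have hTm : Measurable T := by
      intro B _
      have : T ⁻¹' B = ⋃ y ∈ Set.range T ∩ B, T ⁻¹' {y} := by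
        ext x; simp
      rw [this]
      exact MeasurableSet.biUnion (hT1.subset Set.inter_subset_left).countable fun y _ => hT2 y
    have hi1 : Integrable (fun x => f.1 (T x)) (μ : RegMeas K).abs :=
      Integrable.of_bound (hc.measurable.comp hTm).aestronglyMeasurable C
        (Eventually.of_forall fun x => hC _)
    have hi2 : Integrable f.1 (μ : RegMeas K).abs :=
      Integrable.of_bound hc.measurable.aestronglyMeasurable C (Eventually.of_forall fun x => hC _)
    have e1 : Φ ⟨ν, hν1⟩ f = ∫ x, f.1 (T x) ∂(μ : RegMeas K).abs :=
      hν3 f.1 hc.measurable ⟨C, hC⟩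
    rw [e1]
    change |_ - ∫ x, f.1 x ∂(μ : RegMeas K).abs| ≤ ε
    rw [← integral_sub hi1 hi2, ← Real.norm_eq_abs]
    refine (norm_integral_le_of_norm_le_const (Eventually.of_forall
      (hT3 f.1 (Finset.mem_image_of_mem _ hf)))).trans ?_
    change ε / (m + 1) * m ≤ ε
    rw [div_mul_eq_mul_div, div_le_iff₀ (by positivity)]
    nlinarith
  have : (⟨ν, hν1⟩ : posMeas K) ∈ Φ ⁻¹' V := hνV
  rw [hVeq] at this
  exact this (h _ hν2)

/-! ### `M(K)` is a Banach algebra -/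

/-- The value at `E` as a linear functional. -/
def evalL (E : Set K) : RegMeas K →ₗ[ℂ] ℂ where
  toFun μ := μ E
  map_add' _ _ := rfl
  map_smul' _ _ := rfl

section algebra

variable [LocallyCompactSpace K] [SemitopologicalSemihypergroup K]

open SemitopologicalSemihypergroup

instance : Mul (RegMeas K) := ⟨fun μ ν => conv μ ν⟩

theorem mul_eq_conv (μ ν : RegMeas K) : μ * ν = conv μ ν := rfl

instance : NonUnitalRing (RegMeas K) where
  left_distrib μ ν ω := by simp [mul_eq_conv]
  right_distrib μ ν ω := by simp [mul_eq_conv]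
  zero_mul μ := by simp [mul_eq_conv]
  mul_zero μ := by simp [mul_eq_conv]
  mul_assoc μ ν ω := conv_assoc μ ν ω

instance : IsScalarTower ℂ (RegMeas K) (RegMeas K) :=
  ⟨fun c μ ν => by simp [mul_eq_conv, smul_eq_mul]⟩

instance : SMulCommClass ℂ (RegMeas K) (RegMeas K) :=
  ⟨fun c μ ν => by simp [mul_eq_conv, smul_eq_mul]⟩

theorem posMeas_mul {μ ν : RegMeas K} (hμ : μ ∈ posMeas K) (hν : ν ∈ posMeas K) :
    μ * ν ∈ posMeas K := conv_pos μ hμ ν hν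

theorem continuous_mass : Continuous[coneTopology K, inferInstance]
    (fun μ : posMeas K => ‖(μ : RegMeas K)‖) := by
  have h : (fun μ : posMeas K => ‖(μ : RegMeas K)‖) =
      fun μ : posMeas K => ∫ _, (1 : ℝ) ∂(μ : RegMeas K).abs := by
    funext μ
    simp [RegMeas.norm_def]
  rw [h]
  refine continuous_iff_le_induced.2 ?_
  exact iInf₂_le (f := fun (f : K → ℝ) (_ : f ∈ coneTests K) => TopologicalSpace.induced
    (fun μ : posMeas K => ∫ x, f x ∂(μ : RegMeas K).abs) inferInstance) (fun _ => 1) (Or.inr rfl)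

theorem univ_eq_of_span {F G : RegMeas K →ₗ[ℂ] ℂ}
    (h : ∀ x, F (RegMeas.pointMass x) = G (RegMeas.pointMass x)) {μ : RegMeas K}
    (hμ : μ ∈ Submodule.span ℂ (Set.range (RegMeas.pointMass : K → RegMeas K))) : F μ = G μ := by
  refine LinearMap.eqOn_span (s := Set.range (RegMeas.pointMass : K → RegMeas K)) ?_ hμ
  rintro _ ⟨x, rfl⟩
  exact h x

theorem continuous_norm_mul_right (μ : posMeas K) :
    Continuous[coneTopology K, inferInstance]
      (fun ν : posMeas K => ‖conv (μ : RegMeas K) (ν : RegMeas K)‖) := by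
  let τ : TopologicalSpace (posMeas K) := coneTopology K
  have h := continuous_conv_right μ
  generalize hf : (fun ν : posMeas K => (⟨conv μ ν, conv_pos (K := K) μ μ.2 ν ν.2⟩ : posMeas K)) = f at h
  have e : (fun ν : posMeas K => ‖conv (μ : RegMeas K) (ν : RegMeas K)‖) =
      (fun μ : posMeas K => ‖(μ : RegMeas K)‖) ∘ f := by rw [← hf]; rfl
  rw [e]
  exact @Continuous.comp _ _ _ τ τ _ _ _ continuous_mass h

theorem continuous_norm_mul_left (ν : posMeas K) :
    Continuous[coneTopology K, inferInstance]
      (fun μ : posMeas K => ‖conv (μ : RegMeas K) (ν : RegMeas K)‖) := by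
  let τ : TopologicalSpace (posMeas K) := coneTopology K
  have h := continuous_conv_left ν
  generalize hf : (fun μ : posMeas K => (⟨conv μ ν, conv_pos (K := K) μ μ.2 ν ν.2⟩ : posMeas K)) = f at h
  have e : (fun μ : posMeas K => ‖conv (μ : RegMeas K) (ν : RegMeas K)‖) =
      (fun μ : posMeas K => ‖(μ : RegMeas K)‖) ∘ f := by rw [← hf]; rfl
  rw [e]
  exact @Continuous.comp _ _ _ τ τ _ _ _ continuous_mass h

theorem continuous_mass_mul (c : ℝ) : Continuous[coneTopology K, inferInstance]
    (fun μ : posMeas K => ‖(μ : RegMeas K)‖ * c) :=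
  @Continuous.comp _ _ _ (coneTopology K) _ _ (fun μ : posMeas K => ‖(μ : RegMeas K)‖)
    (fun t : ℝ => t * c) (continuous_mul_const c) continuous_mass

theorem mul_univ_pointMass (x : K) {ν : RegMeas K} (hν : ν ∈ posMeas K) :
    (RegMeas.pointMass x * ν) Set.univ = ν Set.univ := by
  have hx := (pointMass_mem x).1
  have h := eq_of_eq_on_finite
    (F := fun ν : posMeas K => ‖conv (RegMeas.pointMass x) (ν : RegMeas K)‖)
    (G := fun ν : posMeas K => ‖(ν : RegMeas K)‖)
    (continuous_norm_mul_right ⟨_, hx⟩) continuous_mass (fun μ hμ => by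
      have h1 := univ_eq_of_span (F := (evalL Set.univ).comp (conv (RegMeas.pointMass x)))
        (G := evalL Set.univ) (fun y => by
          change (conv (RegMeas.pointMass x) (RegMeas.pointMass y)) Set.univ =
            (RegMeas.pointMass y) Set.univ
          rw [(conv_pointMass_mem x y).2, (pointMass_mem y).2]) hμ
      have h2 : (RegMeas.pointMass x * (μ : RegMeas K)) Set.univ = (μ : RegMeas K) Set.univ := h1
      rw [← norm_of_pos (posMeas_mul hx μ.2), ← norm_of_pos μ.2] at h2
      exact_mod_cast h2)
  have h3 := congrFun h ⟨ν, hν⟩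
  rw [← norm_of_pos (posMeas_mul hx hν), ← norm_of_pos hν]
  exact_mod_cast h3

theorem mul_univ_of_pos {μ ν : RegMeas K} (hμ : μ ∈ posMeas K) (hν : ν ∈ posMeas K) :
    (μ * ν) Set.univ = μ Set.univ * ν Set.univ := by
  have h := eq_of_eq_on_finite
    (F := fun μ : posMeas K => ‖conv (μ : RegMeas K) ν‖)
    (G := fun μ : posMeas K => ‖(μ : RegMeas K)‖ * ‖ν‖)
    (continuous_norm_mul_left ⟨ν, hν⟩) (continuous_mass_mul ‖ν‖)
    (fun μ hμ => by
      have h1 := univ_eq_of_span (F := (evalL Set.univ).comp (conv.flip ν))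
        (G := (ν Set.univ) • evalL Set.univ) (fun y => by
          change (RegMeas.pointMass y * ν) Set.univ = ν Set.univ * (RegMeas.pointMass y) Set.univ
          rw [mul_univ_pointMass y hν, (pointMass_mem y).2, mul_one]) hμ
      have h2 : ((μ : RegMeas K) * ν) Set.univ = ν Set.univ * (μ : RegMeas K) Set.univ := h1
      rw [← norm_of_pos (posMeas_mul μ.2 hν), ← norm_of_pos μ.2, ← norm_of_pos hν, mul_comm] at h2
      exact_mod_cast h2)
  have h3 := congrFun h ⟨μ, hμ⟩
  rw [← norm_of_pos (posMeas_mul hμ hν), ← norm_of_pos hν, ← norm_of_pos hμ]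
  exact_mod_cast h3

end algebra

section positive

theorem posFunctional_bound {L : RegMeas K →ₗ[ℂ] ℂ} (hL : ∀ μ ∈ posMeas K, 0 ≤ L μ)
    {ρ : Measure K} [IsFiniteMeasure ρ] [ρ.Regular] {f : K → ℂ} (hf : Integrable f ρ) :
    ((‖L (dens ρ f)‖ : ℝ) : ℂ) ≤ L (dens ρ (fun x => ((‖f x‖ : ℝ) : ℂ))) := by
  have key : ∀ g : K → ℂ, Integrable g ρ → ∃ a b : ℝ, L (dens ρ g) = a + b * Complex.I ∧
      (a : ℂ) ≤ L (dens ρ (fun x => ((‖g x‖ : ℝ) : ℂ))) := by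
    have key0 : ∀ g : K → ℂ, Integrable g ρ → ∀ u : K → ℝ, Integrable u ρ → (∀ x, u x ≤ ‖g x‖) →
        ∃ a : ℝ, L (dens ρ (fun x => (u x : ℂ))) = a ∧
        (a : ℂ) ≤ L (dens ρ (fun x => ((‖g x‖ : ℝ) : ℂ))) := by
      intro g hg u hu hle
      have hn : Integrable (fun x => ((‖g x‖ : ℝ) : ℂ)) ρ := hg.norm.ofReal
      have hu' : Integrable (fun x => (u x : ℂ)) ρ := hu.ofReal
      have hd : Integrable (fun x => ((‖g x‖ - u x : ℝ) : ℂ)) ρ := (hg.norm.sub hu).ofReal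
      have h1 : 0 ≤ L (dens ρ (fun x => ((‖g x‖ : ℝ) : ℂ))) :=
        hL _ (dens_pos hn fun x => by exact_mod_cast norm_nonneg _)
      have h2 : 0 ≤ L (dens ρ (fun x => ((‖g x‖ - u x : ℝ) : ℂ))) := by
        refine hL _ (dens_pos hd fun x => ?_)
        exact_mod_cast sub_nonneg.2 (hle x)
      have h3 : dens ρ (fun x => ((‖g x‖ : ℝ) : ℂ)) =
          dens ρ (fun x => ((‖g x‖ - u x : ℝ) : ℂ)) + dens ρ (fun x => (u x : ℂ)) := by
        rw [← dens_add hd hu']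
        congr 1
        funext x
        simp
      have h4 := congrArg L h3
      rw [map_add] at h4
      rw [Complex.le_def] at h1 h2
      refine ⟨(L (dens ρ (fun x => (u x : ℂ)))).re, ?_, ?_⟩
      · apply Complex.ext
        · simp
        · have := congrArg Complex.im h4
          simp only [Complex.add_im] at this
          rw [← h1.2, ← h2.2] at this
          simpa using this.symm
      · rw [Complex.le_def]
        have := congrArg Complex.re h4
        simp only [Complex.add_re] at this
        refine ⟨?_, ?_⟩
        · rw [this, Complex.ofReal_re]
          have := h2.1
          simp only [Complex.zero_re] at this
          linarith
        · simpa using h1.2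
    intro g hg
    obtain ⟨a, ha, ha'⟩ := key0 g hg (fun x => (g x).re) hg.re
      (fun x => (le_abs_self _).trans (Complex.abs_re_le_norm _))
    obtain ⟨b, hb, _⟩ := key0 g hg (fun x => (g x).im) hg.im
      (fun x => (le_abs_self _).trans (Complex.abs_im_le_norm _))
    refine ⟨a, b, ?_, ha'⟩
    have h5 : dens ρ g = dens ρ (fun x => ((g x).re : ℂ)) +
        Complex.I • dens ρ (fun x => ((g x).im : ℂ)) := by
      have r1 : Integrable (fun x => ((g x).re : ℂ)) ρ := hg.re.ofReal
      have r2 : Integrable (fun x => ((g x).im : ℂ)) ρ := hg.im.ofReal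
      rw [← dens_smul, ← dens_add r1 (r2.smul Complex.I)]
      congr 1
      funext x
      simp only [Pi.add_apply, Pi.smul_apply, smul_eq_mul]
      rw [mul_comm]
      exact (Complex.re_add_im _).symm
    rw [h5, map_add, map_smul, ha, hb, smul_eq_mul, mul_comm]
  set z := L (dens ρ f) with hz
  obtain ⟨c, hc, hcz⟩ : ∃ c : ℂ, ‖c‖ = 1 ∧ c * z = ‖z‖ := by
    by_cases h0 : z = 0
    · exact ⟨1, by simp, by simp [h0]⟩
    · refine ⟨(starRingEnd ℂ) z / ‖z‖, ?_, ?_⟩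
      · rw [norm_div]; simp [h0]
      · have : ((‖z‖ : ℝ) : ℂ) ≠ 0 := by exact_mod_cast norm_ne_zero_iff.2 h0
        rw [div_mul_eq_mul_div, div_eq_iff this, Complex.conj_mul']
        ring
  obtain ⟨a, b, hab, hle⟩ := key (c • f) (hf.smul c)
  rw [dens_smul, map_smul, smul_eq_mul, ← hz, hcz] at hab
  have ha : ‖z‖ = a := by simpa using congrArg Complex.re hab
  rw [ha]
  simpa [norm_smul, hc] using hle

/-- The measure `|μ|` as an element of `M(K)`. -/
def absMeas (μ : RegMeas K) : RegMeas K := dens μ.abs (fun _ => 1)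

theorem absMeas_pos (μ : RegMeas K) : absMeas μ ∈ posMeas K :=
  dens_pos (integrable_const _) fun _ => zero_le_one

theorem norm_absMeas (μ : RegMeas K) : ‖absMeas μ‖ = ‖μ‖ := by
  rw [absMeas, dens_norm (integrable_const _)]
  simp [RegMeas.norm_def]

theorem posFunctional_le {L : RegMeas K →ₗ[ℂ] ℂ} (hL : ∀ μ ∈ posMeas K, 0 ≤ L μ) (μ : RegMeas K) :
    ((‖L μ‖ : ℝ) : ℂ) ≤ L (absMeas μ) := by
  obtain ⟨f, _, hf1, hfi, h⟩ := exists_polar μ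
  have := posFunctional_bound hL hfi
  rw [← h] at this
  simpa [hf1, absMeas] using this

theorem le_re_of_ofReal_le {a : ℝ} {z : ℂ} (h : (a : ℂ) ≤ z) : a ≤ z.re := by
  simpa using (Complex.le_def.1 h).1

/-- Every element of `M(K)` is a combination of positive measures. -/
theorem exists_pos_decomp (μ : RegMeas K) : ∃ μ₁ ∈ posMeas K, ∃ μ₂ ∈ posMeas K,
    ∃ μ₃ ∈ posMeas K, μ = (μ₁ - μ₃) + Complex.I • (μ₂ - μ₃) := by
  obtain ⟨f, hfm, hf1, hfi, h⟩ := exists_polar μ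
  have h1 : Integrable (fun x => ((1 + (f x).re : ℝ) : ℂ)) μ.abs :=
    ((integrable_const 1).add hfi.re).ofReal
  have h2 : Integrable (fun x => ((1 + (f x).im : ℝ) : ℂ)) μ.abs :=
    ((integrable_const 1).add hfi.im).ofReal
  refine ⟨dens μ.abs (fun x => ((1 + (f x).re : ℝ) : ℂ)), dens_pos h1 fun x => ?_,
    dens μ.abs (fun x => ((1 + (f x).im : ℝ) : ℂ)), dens_pos h2 fun x => ?_,
    dens μ.abs (fun _ => 1), dens_pos (integrable_const _) fun _ => zero_le_one, ?_⟩
  · have := (abs_le.1 ((Complex.abs_re_le_norm (f x)).trans (hf1 x).le)).1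
    exact_mod_cast (by linarith : (0 : ℝ) ≤ 1 + (f x).re)
  · have := (abs_le.1 ((Complex.abs_im_le_norm (f x)).trans (hf1 x).le)).1
    exact_mod_cast (by linarith : (0 : ℝ) ≤ 1 + (f x).im)
  · rw [sub_eq_add_neg, sub_eq_add_neg, ← neg_one_smul ℂ (dens μ.abs fun _ => 1), ← dens_smul,
      ← dens_add h1 ((integrable_const _).smul _), ← dens_add h2 ((integrable_const _).smul _),
      ← dens_smul, ← dens_add (h1.add ((integrable_const _).smul _))
        ((h2.add ((integrable_const _).smul _)).smul _)]
    conv_lhs => rw [h]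
    congr 1
    funext x
    simp only [Pi.add_apply, Pi.smul_apply, smul_eq_mul, Complex.ofReal_add, Complex.ofReal_one]
    conv_lhs => rw [← Complex.re_add_im (f x)]
    ring

end positive

section algebra

variable [LocallyCompactSpace K] [SemitopologicalSemihypergroup K]

open SemitopologicalSemihypergroup

theorem mul_univ (μ ν : RegMeas K) : (μ * ν) Set.univ = μ Set.univ * ν Set.univ := by
  obtain ⟨μ₁, h1, μ₂, h2, μ₃, h3, rfl⟩ := exists_pos_decomp μ
  obtain ⟨ν₁, k1, ν₂, k2, ν₃, k3, rfl⟩ := exists_pos_decomp ν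
  simp only [add_mul, mul_add, sub_mul, mul_sub, smul_mul_assoc, mul_smul_comm, smul_sub, smul_add,
    RegMeas.add_apply, RegMeas.sub_apply, RegMeas.smul_apply, mul_univ_of_pos h1 k1,
    mul_univ_of_pos h1 k2, mul_univ_of_pos h1 k3, mul_univ_of_pos h2 k1, mul_univ_of_pos h2 k2,
    mul_univ_of_pos h2 k3, mul_univ_of_pos h3 k1, mul_univ_of_pos h3 k2, mul_univ_of_pos h3 k3]
  ring

theorem apply_le_univ (μ : RegMeas K) (E : Set K) :
    (μ E).re ≤ ‖μ‖ :=
  (Complex.re_le_norm _).trans (RegMeas.norm_apply_le μ E)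

theorem norm_mul_of_pos {μ ν : RegMeas K} (hμ : μ ∈ posMeas K) (hν : ν ∈ posMeas K) :
    ‖μ * ν‖ = ‖μ‖ * ‖ν‖ := by
  have := mul_univ_of_pos hμ hν
  rw [← norm_of_pos (posMeas_mul hμ hν), ← norm_of_pos hμ, ← norm_of_pos hν] at this
  exact_mod_cast this

/-- `μ ↦ (μ * ν)(E)`. -/
def mulEvalL (E : Set K) (ν : RegMeas K) : RegMeas K →ₗ[ℂ] ℂ := (evalL E).comp (conv.flip ν)

theorem continuous_mulEvalL (E : Set K) (ν : RegMeas K) : Continuous (mulEvalL E ν) := by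
  have hpos : ∀ ν ∈ posMeas K, Continuous (mulEvalL E ν) := by
    intro ν hν
    refine AddMonoidHomClass.continuous_of_bound (mulEvalL E ν) ‖ν‖ fun μ => ?_
    have h1 := le_re_of_ofReal_le (posFunctional_le (L := mulEvalL E ν) (fun μ hμ => posMeas_mul hμ hν E) μ)
    refine h1.trans ((apply_le_univ (absMeas μ * ν) E).trans ?_)
    rw [norm_mul_of_pos (absMeas_pos μ) hν, norm_absMeas, mul_comm]
  obtain ⟨ν₁, k1, ν₂, k2, ν₃, k3, rfl⟩ := exists_pos_decomp ν
  have : (mulEvalL E (ν₁ - ν₃ + Complex.I • (ν₂ - ν₃)) : RegMeas K → ℂ) = fun μ =>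
      (mulEvalL E ν₁ μ - mulEvalL E ν₃ μ) +
        Complex.I * (mulEvalL E ν₂ μ - mulEvalL E ν₃ μ) := by
    funext μ
    simp [mulEvalL, evalL]
  rw [this]
  have c1 := hpos _ k1
  have c2 := hpos _ k2
  have c3 := hpos _ k3
  fun_prop

theorem norm_mul_apply_le (μ ν : RegMeas K) (E : Set K) :
    ‖(μ * ν) E‖ ≤ ((absMeas μ * absMeas ν) E).re := by
  obtain ⟨f, hfm, hf1, hfi, h⟩ := exists_polar μ
  set ρ := μ.abs with hρ
  have hdn : ∀ {g : K → ℂ}, Integrable g ρ → Integrable (fun x => ((‖g x‖ : ℝ) : ℂ)) ρ :=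
    fun hg => hg.norm.ofReal
  suffices H : ∀ g : K → ℂ, Integrable g ρ → ‖mulEvalL E ν (dens ρ g)‖ ≤
      (mulEvalL E (absMeas ν) (dens ρ (fun x => ((‖g x‖ : ℝ) : ℂ)))).re by
    have := H f hfi
    rw [← h] at this
    simp only [hf1, Complex.ofReal_one] at this
    exact this
  intro g hg
  refine Integrable.induction (fun g => ‖mulEvalL E ν (dens ρ g)‖ ≤
      (mulEvalL E (absMeas ν) (dens ρ (fun x => ((‖g x‖ : ℝ) : ℂ)))).re) ?_ ?_ ?_ ?_ hg
  · intro c s hs _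
    have hi : Integrable (s.indicator fun _ => (1 : ℂ)) ρ :=
      (integrable_const 1).indicator hs
    have hp : dens ρ (s.indicator fun _ => (1 : ℂ)) ∈ posMeas K :=
      dens_pos hi fun x => Set.indicator_nonneg (fun _ _ => zero_le_one) x
    have e1 : (s.indicator fun _ => c) = c • s.indicator fun _ => (1 : ℂ) := by
      funext x
      by_cases hx : x ∈ s <;> simp [hx]
    have e2 : (fun x => ((‖s.indicator (fun _ => c) x‖ : ℝ) : ℂ)) =
        ((‖c‖ : ℝ) : ℂ) • s.indicator fun _ => (1 : ℂ) := by
      funext x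
      by_cases hx : x ∈ s <;> simp [hx]
    rw [e2, e1, dens_smul, dens_smul, map_smul, map_smul, smul_eq_mul, smul_eq_mul, norm_mul,
      Complex.re_ofReal_mul]
    refine mul_le_mul_of_nonneg_left ?_ (norm_nonneg _)
    exact le_re_of_ofReal_le (posFunctional_le (L := (evalL E).comp (conv (dens ρ (s.indicator fun _ => (1 : ℂ)))))
      (fun ν hν => posMeas_mul hp hν E) ν)
  · intro g₁ g₂ hdisj h1 h2 hg1 hg2
    have e : (fun x => ((‖(g₁ + g₂) x‖ : ℝ) : ℂ)) =
        (fun x => ((‖g₁ x‖ : ℝ) : ℂ)) + fun x => ((‖g₂ x‖ : ℝ) : ℂ) := by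
      funext x
      by_cases hx : x ∈ Function.support g₁
      · have : g₂ x = 0 := by
          by_contra h0
          exact Set.disjoint_left.1 hdisj hx h0
        simp [this]
      · have : g₁ x = 0 := by simpa using hx
        simp [this]
    rw [e, dens_add h1 h2, dens_add (hdn h1) (hdn h2), map_add, map_add, Complex.add_re]
    exact (norm_add_le _ _).trans (add_le_add hg1 hg2)
  · have hc1 : Continuous fun g : K →₁[ρ] ℂ => dens ρ g := (densL ρ).continuous
    have hc2 : Continuous fun g : K →₁[ρ] ℂ => dens ρ (fun x => ((‖g x‖ : ℝ) : ℂ)) := by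
      refine LipschitzWith.continuous (K := 1) (LipschitzWith.of_dist_le_mul fun g₁ g₂ => ?_)
      have i1 := L1.integrable_coeFn g₁
      have i2 := L1.integrable_coeFn g₂
      have i3 : Integrable (fun x => ((‖g₁ x‖ - ‖g₂ x‖ : ℝ) : ℂ)) ρ := (i1.norm.sub i2.norm).ofReal
      have e : dens ρ (fun x => ((‖g₁ x‖ : ℝ) : ℂ)) - dens ρ (fun x => ((‖g₂ x‖ : ℝ) : ℂ)) =
          dens ρ (fun x => ((‖g₁ x‖ - ‖g₂ x‖ : ℝ) : ℂ)) := by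
        rw [sub_eq_iff_eq_add, ← dens_add i3 (hdn i2)]
        congr 1
        funext x
        simp
      rw [dist_eq_norm, e, dens_norm i3, NNReal.coe_one, one_mul,
        dist_eq_norm, L1.norm_eq_integral_norm]
      have e3 : ∀ᵐ x ∂ρ, ‖(g₁ - g₂ : K →₁[ρ] ℂ) x‖ = ‖g₁ x - g₂ x‖ := by
        filter_upwards [Lp.coeFn_sub g₁ g₂] with x hx
        rw [hx, Pi.sub_apply]
      rw [integral_congr_ae e3]
      refine integral_mono i3.norm (i1.sub i2).norm fun x => ?_
      simp only [Complex.norm_real, Real.norm_eq_abs]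
      exact abs_norm_sub_norm_le _ _
    exact isClosed_le ((continuous_mulEvalL E ν).comp hc1).norm
      (Complex.continuous_re.comp ((continuous_mulEvalL E (absMeas ν)).comp hc2))
  · intro g₁ g₂ hgg _ h1
    have h2 : (fun x => ((‖g₁ x‖ : ℝ) : ℂ)) =ᵐ[ρ] fun x => ((‖g₂ x‖ : ℝ) : ℂ) := by
      filter_upwards [hgg] with x hx
      rw [hx]
    rw [← dens_congr hgg, ← dens_congr h2]
    exact h1

theorem measNorm_mul_le (μ ν : RegMeas K) : ‖μ * ν‖ ≤ ‖μ‖ * ‖ν‖ := by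
  have hp := posMeas_mul (absMeas_pos μ) (absMeas_pos ν)
  have h : (μ * ν).abs ≤ (absMeas μ * absMeas ν).abs := by
    refine VectorMeasure.variation_le_of_forall_enorm_le fun E hE => ?_
    rw [abs_apply_of_pos hp hE, ← ofReal_norm]
    exact ENNReal.ofReal_le_ofReal (norm_mul_apply_le μ ν E)
  calc ‖μ * ν‖ ≤ ‖absMeas μ * absMeas ν‖ := by
        rw [RegMeas.norm_def, RegMeas.norm_def]
        exact ENNReal.toReal_mono (measure_ne_top _ _) (h _)
    _ = ‖μ‖ * ‖ν‖ := by
        rw [norm_mul_of_pos (absMeas_pos μ) (absMeas_pos ν), norm_absMeas, norm_absMeas]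

instance : NonUnitalNormedRing (RegMeas K) where
  dist_eq := NormedAddGroup.dist_eq
  norm_mul_le := measNorm_mul_le

end algebra

/-! ### Completeness of `M(K)` -/

instance : CompleteSpace (RegMeas K) := by
  refine NormedAddCommGroup.completeSpace_of_summable_imp_tendsto fun u hu => ?_
  let ρ : Measure K := Measure.sum fun n => (u n).abs
  have hfin : IsFiniteMeasure ρ := by
    refine ⟨?_⟩
    rw [Measure.sum_apply _ MeasurableSet.univ]
    have h1 : ∀ n, (u n).abs Set.univ = ENNReal.ofReal ‖u n‖ := fun n => by
      rw [RegMeas.norm_def, measureReal_def, ENNReal.ofReal_toReal (measure_ne_top _ _)]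
    simp_rw [h1]
    rw [← ENNReal.ofReal_tsum_of_nonneg (fun n => norm_nonneg _) hu]
    exact ENNReal.ofReal_lt_top
  have hir : ∀ n, (u n).abs.InnerRegular := fun n => inferInstance
  have hreg : ρ.Regular := by
    have : ρ.InnerRegular := inferInstanceAs (Measure.InnerRegular (Measure.sum fun n => (u n).abs))
    infer_instance
  have hex : ∀ n, ∃ F : K →₁[ρ] ℂ, u n = densL ρ F := by
    intro n
    obtain ⟨f, _, hf, h⟩ := exists_dens (μ := u n) (ρ := ρ)
      (Measure.absolutelyContinuous_of_le (Measure.le_sum (fun n => (u n).abs) n))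
    refine ⟨hf.toL1 f, ?_⟩
    rw [h]
    exact dens_congr hf.coeFn_toL1.symm
  choose F hF using hex
  have hs : Summable F := by
    refine Summable.of_norm ?_
    refine hu.congr fun n => ?_
    rw [hF n, LinearIsometry.norm_map]
  refine ⟨densL ρ (∑' n, F n), ?_⟩
  have h2 := ((densL ρ).continuous.tendsto _).comp hs.hasSum.tendsto_sum_nat
  refine h2.congr fun n => ?_
  simp only [Function.comp_apply, map_sum]
  exact Finset.sum_congr rfl fun i _ => (hF i).symm

/-! ### The W*-algebra `M(K)^*` -/

section wstar

/-- The restriction `μ|_E`. -/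
def restr (E : Set K) : RegMeas K →ₗ[ℂ] RegMeas K where
  toFun μ := ⟨μ.toComplex.restrict E,
    regular_of_le (VectorMeasure.variation_restrict_le.trans Measure.restrict_le_self)
      (inferInstanceAs μ.abs.Regular)⟩
  map_add' _ _ := Subtype.ext (VectorMeasure.restrict_add _ _ E)
  map_smul' c _ := Subtype.ext (VectorMeasure.restrict_smul c)

theorem restr_apply {E F : Set K} (hE : MeasurableSet E) (hF : MeasurableSet F) (μ : RegMeas K) :
    restr E μ F = μ (F ∩ E) := VectorMeasure.restrict_apply _ hE hF

theorem restr_of_not {E : Set K} (hE : ¬ MeasurableSet E) (μ : RegMeas K) : restr E μ = 0 :=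
  Subtype.ext (VectorMeasure.restrict_not_measurable _ hE)

theorem norm_restr_le (E : Set K) (μ : RegMeas K) : ‖restr E μ‖ ≤ μ.abs.real E := by
  by_cases hE : MeasurableSet E
  · have : (restr E μ).abs ≤ μ.abs.restrict E := VectorMeasure.variation_restrict_le
    rw [RegMeas.norm_def]
    refine (ENNReal.toReal_mono (measure_ne_top _ _) (this Set.univ)).trans ?_
    rw [Measure.restrict_apply_univ]
    exact le_rfl
  · rw [restr_of_not hE, norm_zero]
    exact measureReal_nonneg

theorem restr_univ (μ : RegMeas K) : restr Set.univ μ = μ :=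
  Subtype.ext (VectorMeasure.restrict_univ _)

theorem restr_union {E F : Set K} (hE : MeasurableSet E) (hF : MeasurableSet F)
    (h : Disjoint E F) (μ : RegMeas K) : restr (E ∪ F) μ = restr E μ + restr F μ :=
  Subtype.ext (VectorMeasure.restrict_union h hE hF)

theorem restr_restr {E F : Set K} (hE : MeasurableSet E) (hF : MeasurableSet F) (μ : RegMeas K) :
    restr E (restr F μ) = restr (E ∩ F) μ := by
  refine RegMeas.ext fun G hG => ?_
  rw [restr_apply hE hG, restr_apply hF (hG.inter hE), restr_apply (hE.inter hF) hG,
    Set.inter_assoc]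

variable (K)

/-- The dual space `M(K)^*`. -/
def MDual : Type u := StrongDual ℂ (RegMeas K)

instance : NormedAddCommGroup (MDual K) :=
  inferInstanceAs (NormedAddCommGroup (StrongDual ℂ (RegMeas K)))

instance : NormedSpace ℂ (MDual K) := inferInstanceAs (NormedSpace ℂ (StrongDual ℂ (RegMeas K)))

instance : CompleteSpace (MDual K) := inferInstanceAs (CompleteSpace (StrongDual ℂ (RegMeas K)))

instance : FunLike (MDual K) (RegMeas K) ℂ :=
  inferInstanceAs (FunLike (StrongDual ℂ (RegMeas K)) (RegMeas K) ℂ)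

instance : ContinuousLinearMapClass (MDual K) ℂ (RegMeas K) ℂ :=
  inferInstanceAs (ContinuousLinearMapClass (StrongDual ℂ (RegMeas K)) ℂ (RegMeas K) ℂ)

/-- The functional `𝟙 : μ ↦ μ(K)`. -/
def oneFunctional : StrongDual ℂ (RegMeas K) :=
  (evalL Set.univ).mkContinuous 1 fun μ => by
    rw [one_mul]; exact RegMeas.norm_apply_le μ Set.univ

variable {K}

@[simp] theorem oneFunctional_apply (μ : RegMeas K) : oneFunctional K μ = μ Set.univ := rfl

namespace MDual

theorem ext {φ ψ : MDual K} (h : ∀ μ, φ μ = ψ μ) : φ = ψ := DFunLike.ext _ _ h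

theorem le_norm (φ : MDual K) (μ : RegMeas K) : ‖φ μ‖ ≤ ‖φ‖ * ‖μ‖ :=
  ContinuousLinearMap.le_opNorm (E := RegMeas K) φ μ

theorem norm_le {φ : MDual K} {C : ℝ} (hC : 0 ≤ C) (h : ∀ μ, ‖φ μ‖ ≤ C * ‖μ‖) : ‖φ‖ ≤ C :=
  ContinuousLinearMap.opNorm_le_bound (E := RegMeas K) φ hC h

@[simp] theorem add_apply (φ ψ : MDual K) (μ : RegMeas K) : (φ + ψ) μ = φ μ + ψ μ := rfl

@[simp] theorem smul_apply (c : ℂ) (φ : MDual K) (μ : RegMeas K) : (c • φ) μ = c * φ μ := rfl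

@[simp] theorem zero_apply (μ : RegMeas K) : (0 : MDual K) μ = 0 := rfl

theorem enorm_restr_le (φ : MDual K) (μ : RegMeas K) (E : Set K) :
    ‖φ (restr E μ)‖ₑ ≤ (‖φ‖₊ • μ.abs) E := by
  rw [← ofReal_norm]
  refine (ENNReal.ofReal_le_ofReal ((le_norm φ _).trans
    (mul_le_mul_of_nonneg_left (norm_restr_le E μ) (norm_nonneg _)))).trans ?_
  rw [ENNReal.ofReal_mul (norm_nonneg _), measureReal_def,
    ENNReal.ofReal_toReal (measure_ne_top _ _), Measure.smul_apply, ENNReal.smul_def, smul_eq_mul, ofReal_norm]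
  rfl

/-- The measure `φ · μ : E ↦ φ(μ|_E)`. -/
def act (φ : MDual K) (μ : RegMeas K) : RegMeas K :=
  ⟨VectorMeasure.of_additive_of_le_measure (μ := ‖φ‖₊ • μ.abs) (fun E => φ (restr E μ))
    (enorm_restr_le φ μ)
    (fun E F hE hF h => by rw [restr_union hE hF h, map_add])
    (fun E hE => by rw [restr_of_not hE, map_zero]), by
    refine regular_of_le (ν := ‖φ‖₊ • μ.abs) ?_ inferInstance
    exact VectorMeasure.variation_le_of_forall_enorm_le fun E _ => enorm_restr_le φ μ E⟩

theorem act_apply (φ : MDual K) (μ : RegMeas K) (E : Set K) : act φ μ E = φ (restr E μ) := rfl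

theorem act_abs_le (φ : MDual K) (μ : RegMeas K) : (act φ μ).abs ≤ ‖φ‖₊ • μ.abs :=
  VectorMeasure.variation_le_of_forall_enorm_le fun E _ => enorm_restr_le φ μ E

theorem norm_act_le (φ : MDual K) (μ : RegMeas K) : ‖act φ μ‖ ≤ ‖φ‖ * ‖μ‖ := by
  rw [RegMeas.norm_def, RegMeas.norm_def]
  refine (ENNReal.toReal_mono (measure_ne_top _ _) (act_abs_le φ μ Set.univ)).trans ?_
  rw [Measure.smul_apply, ENNReal.smul_def, smul_eq_mul, ENNReal.toReal_mul]
  exact le_rfl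

theorem act_add (φ : MDual K) (μ ν : RegMeas K) : act φ (μ + ν) = act φ μ + act φ ν :=
  RegMeas.ext fun E _ => by simp [act_apply]

theorem act_smul (φ : MDual K) (c : ℂ) (μ : RegMeas K) : act φ (c • μ) = c • act φ μ :=
  RegMeas.ext fun E _ => by simp [act_apply]

theorem restr_act (φ : MDual K) (μ : RegMeas K) (E : Set K) :
    restr E (act φ μ) = act φ (restr E μ) := by
  by_cases hE : MeasurableSet E
  · refine RegMeas.ext fun F hF => ?_
    rw [restr_apply hE hF, act_apply, act_apply, restr_restr hF hE]
  · rw [restr_of_not hE, restr_of_not hE]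
    exact RegMeas.ext fun F _ => by simp [act_apply]

instance : Mul (MDual K) := ⟨fun φ ψ =>
  (show StrongDual ℂ (RegMeas K) from LinearMap.mkContinuous
    { toFun := fun μ => φ (act ψ μ)
      map_add' := fun μ ν => by rw [act_add, map_add]
      map_smul' := fun c μ => by rw [act_smul, map_smul]; rfl } (‖φ‖ * ‖ψ‖)
    (fun μ => by
      refine (le_norm φ _).trans ?_
      rw [mul_assoc]
      exact mul_le_mul_of_nonneg_left (norm_act_le ψ μ) (norm_nonneg _)))⟩

instance : One (MDual K) := ⟨oneFunctional K⟩

theorem mul_apply (φ ψ : MDual K) (μ : RegMeas K) : (φ * ψ) μ = φ (act ψ μ) := rfl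

theorem one_apply (μ : RegMeas K) : (1 : MDual K) μ = μ Set.univ := rfl

theorem act_mul (φ ψ : MDual K) (μ : RegMeas K) : act (φ * ψ) μ = act φ (act ψ μ) :=
  RegMeas.ext fun E _ => by rw [act_apply, act_apply, mul_apply, restr_act]

theorem act_one (μ : RegMeas K) : act 1 μ = μ := by
  refine RegMeas.ext fun E hE => ?_
  rw [act_apply, one_apply, restr_apply hE MeasurableSet.univ, Set.univ_inter]

theorem norm_mul_le (φ ψ : MDual K) : ‖φ * ψ‖ ≤ ‖φ‖ * ‖ψ‖ :=
  LinearMap.mkContinuous_norm_le _ (mul_nonneg (norm_nonneg _) (norm_nonneg _)) _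

instance : NormedRing (MDual K) where
  left_distrib φ ψ χ := ext fun μ => by
    have : act (ψ + χ) μ = act ψ μ + act χ μ := RegMeas.ext fun E _ => by simp [act_apply]
    simp [mul_apply, this]
  right_distrib φ ψ χ := ext fun μ => by simp [mul_apply]
  zero_mul φ := ext fun μ => by simp [mul_apply]
  mul_zero φ := ext fun μ => by
    have : act (0 : MDual K) μ = 0 := RegMeas.ext fun E _ => by simp [act_apply]
    rw [mul_apply, this, map_zero, zero_apply]
  mul_assoc φ ψ χ := ext fun μ => by rw [mul_apply, mul_apply, mul_apply, act_mul]
  one_mul φ := ext fun μ => by rw [mul_apply, one_apply, act_apply, restr_univ]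
  mul_one φ := ext fun μ => by rw [mul_apply, act_one]
  dist_eq := NormedAddGroup.dist_eq
  norm_mul_le := norm_mul_le

instance : Algebra ℂ (MDual K) := Algebra.ofModule
  (fun c φ ψ => ext fun μ => by simp [mul_apply])
  (fun c φ ψ => ext fun μ => by
    have : act (c • ψ) μ = c • act ψ μ := RegMeas.ext fun E _ => by simp [act_apply]
    rw [mul_apply, this, map_smul]; rfl)

instance : NormedAlgebra ℂ (MDual K) where
  norm_smul_le c φ := _root_.norm_smul_le c φ

/-- Every functional is given by a bounded density on `L¹(ρ)`. -/
theorem exists_density (φ : MDual K) (ρ : Measure K) [IsFiniteMeasure ρ] [ρ.Regular] :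
    ∃ g : K → ℂ, Measurable g ∧ (∀ x, ‖g x‖ ≤ ‖φ‖) ∧
      ∀ f : K → ℂ, Integrable f ρ → φ (dens ρ f) = ∫ x, f x * g x ∂ρ := by
  have i1 : Integrable (fun _ : K => (1 : ℂ)) ρ := integrable_const _
  set μ₀ := dens ρ (fun _ => 1) with hμ₀
  have habs : μ₀.abs = ρ := by
    rw [hμ₀, dens_abs i1]
    simp
  obtain ⟨g₀, hm, hi, hg⟩ := exists_dens (μ := act φ μ₀) (ρ := ρ) (by
    have h1 := act_abs_le φ μ₀
    rw [habs] at h1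
    exact (Measure.absolutelyContinuous_of_le h1).trans (Measure.smul_absolutelyContinuous))
  have hle : ∀ᵐ x ∂ρ, ‖g₀ x‖ₑ ≤ ‖φ‖ₑ := by
    refine ae_le_of_forall_setLIntegral_le_of_sigmaFinite hm.enorm fun s hs _ => ?_
    rw [← withDensity_apply _ hs, ← dens_abs hi, ← hg, setLIntegral_const]
    have h1 := act_abs_le φ μ₀ s
    rw [habs] at h1
    exact h1
  classical
  set g : K → ℂ := fun x => if ‖g₀ x‖ₑ ≤ ‖φ‖ₑ then g₀ x else 0 with hgdef
  have hgm : Measurable g :=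
    Measurable.ite (measurableSet_le hm.enorm measurable_const) hm measurable_const
  have hgg : g₀ =ᵐ[ρ] g := by
    filter_upwards [hle] with x hx
    simp [hgdef, hx]
  have hgb : ∀ x, ‖g x‖ ≤ ‖φ‖ := by
    intro x
    by_cases hx : ‖g₀ x‖ₑ ≤ ‖φ‖ₑ
    · simp only [hgdef, hx, if_true]
      exact enorm_le_iff_norm_le.1 hx
    · simp [hgdef, hx]
  have hmul : ∀ {f : K → ℂ}, Integrable f ρ → Integrable (fun x => f x * g x) ρ := fun hf =>
    hf.mul_bdd hgm.aestronglyMeasurable (Eventually.of_forall hgb)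
  refine ⟨g, hgm, hgb, fun f hf => ?_⟩
  refine Integrable.induction (fun f => φ (dens ρ f) = ∫ x, f x * g x ∂ρ) ?_ ?_ ?_ ?_ hf
  · intro c s hs _
    have e1 : dens ρ (s.indicator fun _ => c) = c • restr s μ₀ := by
      refine RegMeas.ext fun E hE => ?_
      rw [dens_apply ((integrable_const c).indicator hs) hE, RegMeas.smul_apply,
        restr_apply hs hE, hμ₀, dens_apply i1 (hE.inter hs), setIntegral_indicator hs]
      simp [mul_comm]
    rw [e1, map_smul, ← act_apply, hg, dens_apply hi hs, smul_eq_mul, ← integral_const_mul,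
      ← integral_indicator hs]
    refine integral_congr_ae ?_
    filter_upwards [hgg] with x hx
    by_cases hxs : x ∈ s <;> simp [hxs, hx]
  · intro f₁ f₂ _ h1 h2 e1 e2
    rw [dens_add h1 h2, map_add, e1, e2, ← integral_add (hmul h1) (hmul h2)]
    simp [add_mul]
  · have hc1 : Continuous fun f : K →₁[ρ] ℂ => φ (dens ρ f) :=
      (map_continuous φ).comp (densL ρ).continuous
    have hc2 : Continuous fun f : K →₁[ρ] ℂ => ∫ x, f x * g x ∂ρ := by
      refine LipschitzWith.continuous (K := ‖φ‖₊) (LipschitzWith.of_dist_le_mul fun f₁ f₂ => ?_)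
      have j1 := L1.integrable_coeFn f₁
      have j2 := L1.integrable_coeFn f₂
      rw [dist_eq_norm, ← integral_sub (hmul j1) (hmul j2), dist_eq_norm, L1.norm_eq_integral_norm,
        ← integral_const_mul]
      refine (norm_integral_le_integral_norm _).trans (integral_mono_ae ((hmul j1).sub
        (hmul j2)).norm ((L1.integrable_coeFn (f₁ - f₂)).norm.const_mul _) ?_)
      filter_upwards [Lp.coeFn_sub f₁ f₂] with x hx
      rw [hx, Pi.sub_apply, ← sub_mul, norm_mul, mul_comm]
      exact mul_le_mul_of_nonneg_right (hgb x) (norm_nonneg _)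
    exact isClosed_eq hc1 hc2
  · intro f₁ f₂ hff _ h1
    rw [← dens_congr hff, h1]
    refine integral_congr_ae ?_
    filter_upwards [hff] with x hx
    rw [hx]

theorem act_dens {φ : MDual K} {ρ : Measure K} [IsFiniteMeasure ρ] [ρ.Regular] {g : K → ℂ}
    (hg : Measurable g) (hb : ∀ x, ‖g x‖ ≤ ‖φ‖)
    (h : ∀ f : K → ℂ, Integrable f ρ → φ (dens ρ f) = ∫ x, f x * g x ∂ρ)
    {f : K → ℂ} (hf : Integrable f ρ) :
    Integrable (fun x => f x * g x) ρ ∧ act φ (dens ρ f) = dens ρ (fun x => f x * g x) := by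
  have hi : Integrable (fun x => f x * g x) ρ :=
    hf.mul_bdd hg.aestronglyMeasurable (Eventually.of_forall hb)
  refine ⟨hi, RegMeas.ext fun E hE => ?_⟩
  have e1 : restr E (dens ρ f) = dens ρ (E.indicator f) := by
    refine RegMeas.ext fun F hF => ?_
    rw [restr_apply hE hF, dens_apply hf (hF.inter hE), dens_apply (hf.indicator hE) hF,
      setIntegral_indicator hE]
  rw [act_apply, e1, h _ (hf.indicator hE), dens_apply hi hE, ← integral_indicator hE]
  refine integral_congr_ae (Eventually.of_forall fun x => ?_)
  by_cases hx : x ∈ E <;> simp [hx]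

protected theorem mul_comm (φ ψ : MDual K) : φ * ψ = ψ * φ := by
  refine ext fun μ => ?_
  obtain ⟨f, _, _, hfi, h⟩ := exists_polar μ
  obtain ⟨g₁, m1, b1, h1⟩ := exists_density φ μ.abs
  obtain ⟨g₂, m2, b2, h2⟩ := exists_density ψ μ.abs
  obtain ⟨i1, a1⟩ := act_dens m1 b1 h1 hfi
  obtain ⟨i2, a2⟩ := act_dens m2 b2 h2 hfi
  rw [h, mul_apply, mul_apply, a1, a2, h1 _ i2, h2 _ i1]
  refine integral_congr_ae (Eventually.of_forall fun x => ?_)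
  simp only
  ring

/-- The complex conjugate of a measure. -/
def conjMeas (μ : RegMeas K) : RegMeas K :=
  ⟨μ.toComplex.mapRange (starRingEnd ℂ).toAddMonoidHom Complex.continuous_conj, by
    refine regular_of_le (ν := μ.abs) ?_ inferInstance
    refine VectorMeasure.variation_le_of_forall_enorm_le fun E _ => ?_
    refine le_trans (le_of_eq ?_) (VectorMeasure.enorm_measure_le_variation μ.toComplex E)
    change ‖(starRingEnd ℂ) (μ E)‖ₑ = ‖μ E‖ₑ
    rw [← ofReal_norm, ← ofReal_norm, RCLike.norm_conj]⟩

theorem conjMeas_apply (μ : RegMeas K) (E : Set K) : conjMeas μ E = (starRingEnd ℂ) (μ E) := rfl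

theorem conj_conj (μ : RegMeas K) : conjMeas (conjMeas μ) = μ :=
  RegMeas.ext fun E _ => by simp [conjMeas_apply]

theorem conj_add (μ ν : RegMeas K) : conjMeas (μ + ν) = conjMeas μ + conjMeas ν :=
  RegMeas.ext fun E _ => by simp [conjMeas_apply]

theorem conj_smul (c : ℂ) (μ : RegMeas K) :
    conjMeas (c • μ) = (starRingEnd ℂ) c • conjMeas μ :=
  RegMeas.ext fun E _ => by simp [conjMeas_apply]

theorem norm_conj_le (μ : RegMeas K) : ‖conjMeas μ‖ ≤ ‖μ‖ := by
  have : (conjMeas μ).abs ≤ μ.abs := by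
    refine VectorMeasure.variation_le_of_forall_enorm_le fun E _ => ?_
    refine le_trans (le_of_eq ?_) (VectorMeasure.enorm_measure_le_variation μ.toComplex E)
    change ‖(starRingEnd ℂ) (μ E)‖ₑ = ‖μ E‖ₑ
    rw [← ofReal_norm, ← ofReal_norm, RCLike.norm_conj]
  exact ENNReal.toReal_mono (measure_ne_top _ _) (this Set.univ)

theorem restr_conj (E : Set K) (μ : RegMeas K) : restr E (conjMeas μ) = conjMeas (restr E μ) := by
  by_cases hE : MeasurableSet E
  · refine RegMeas.ext fun F hF => ?_
    rw [restr_apply hE hF, conjMeas_apply, conjMeas_apply, restr_apply hE hF]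
  · rw [restr_of_not hE, restr_of_not hE]
    exact RegMeas.ext fun F _ => by simp [conjMeas_apply]

theorem conj_dens {ρ : Measure K} [IsFiniteMeasure ρ] [ρ.Regular] {f : K → ℂ}
    (hf : Integrable f ρ) :
    conjMeas (dens ρ f) = dens ρ (fun x => (starRingEnd ℂ) (f x)) := by
  have hi : Integrable (fun x => (starRingEnd ℂ) (f x)) ρ :=
    (LinearIsometryEquiv.integrable_comp_iff Complex.conjLIE).2 hf
  refine RegMeas.ext fun E hE => ?_
  rw [conjMeas_apply, dens_apply hf hE, dens_apply hi hE, integral_conj]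

/-- The involution `φ^*(μ) = conj (φ (conj μ))`. -/
instance : Star (MDual K) := ⟨fun φ =>
  (show StrongDual ℂ (RegMeas K) from LinearMap.mkContinuous
    { toFun := fun μ => (starRingEnd ℂ) (φ (conjMeas μ))
      map_add' := fun μ ν => by rw [conj_add, map_add, map_add]
      map_smul' := fun c μ => by rw [conj_smul, map_smul]; simp } ‖φ‖
    (fun μ => by
      change ‖(starRingEnd ℂ) (φ (conjMeas μ))‖ ≤ _
      rw [RCLike.norm_conj]
      exact (le_norm φ _).trans (mul_le_mul_of_nonneg_left (norm_conj_le μ) (norm_nonneg _))))⟩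

theorem star_apply (φ : MDual K) (μ : RegMeas K) :
    (star φ) μ = (starRingEnd ℂ) (φ (conjMeas μ)) := rfl

theorem act_conj (φ : MDual K) (μ : RegMeas K) :
    act φ (conjMeas μ) = conjMeas (act (star φ) μ) := by
  refine RegMeas.ext fun E _ => ?_
  rw [act_apply, conjMeas_apply, act_apply, star_apply, restr_conj, Complex.conj_conj]

instance : StarRing (MDual K) where
  star_involutive φ := ext fun μ => by
    rw [star_apply, star_apply, conj_conj, Complex.conj_conj]
  star_mul φ ψ := ext fun μ => by
    rw [MDual.mul_comm (star ψ), star_apply, mul_apply, mul_apply, act_conj, star_apply]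
  star_add φ ψ := ext fun μ => by
    rw [star_apply, add_apply, add_apply, star_apply, star_apply, map_add]

instance : StarModule ℂ (MDual K) where
  star_smul c φ := ext fun μ => by
    rw [star_apply, smul_apply, smul_apply, star_apply, map_mul]; rfl

instance : CStarRing (MDual K) where
  norm_mul_self_le φ := by
    have key : ∀ μ : RegMeas K, ‖φ μ‖ ^ 2 ≤ ‖star φ * φ‖ * ‖μ‖ ^ 2 := by
      intro μ
      obtain ⟨f, hfm, hf1, hfi, h⟩ := exists_polar μ
      obtain ⟨g, m, b, hg⟩ := exists_density φ μ.abs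
      set ρ := μ.abs with hρ
      have i1 : Integrable (fun _ : K => (1 : ℂ)) ρ := integrable_const _
      have gi : Integrable g ρ :=
        Integrable.of_bound m.aestronglyMeasurable ‖φ‖ (Eventually.of_forall b)
      have gi2 : Integrable (fun x => ‖g x‖ ^ 2) ρ := by
        refine Integrable.of_bound (m.norm.pow_const 2).aestronglyMeasurable (‖φ‖ ^ 2)
          (Eventually.of_forall fun x => ?_)
        rw [Real.norm_of_nonneg (by positivity)]
        exact pow_le_pow_left₀ (norm_nonneg _) (b x) 2
      obtain ⟨j, a⟩ := act_dens m b hg i1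
      simp only [one_mul] at j a
      have hconj : Integrable (fun x => (starRingEnd ℂ) (g x)) ρ :=
        (LinearIsometryEquiv.integrable_comp_iff Complex.conjLIE).2 gi
      have e1 : (star φ * φ) (dens ρ fun _ => 1) = ((∫ x, ‖g x‖ ^ 2 ∂ρ : ℝ) : ℂ) := by
        rw [mul_apply, a, star_apply, conj_dens gi, hg _ hconj, ← integral_conj,
          ← integral_complex_ofReal]
        refine integral_congr_ae (Eventually.of_forall fun x => ?_)
        simp only [map_mul, Complex.conj_conj, Complex.ofReal_pow]
        exact Complex.mul_conj' (g x)
      have n1 : ‖dens ρ fun _ => (1 : ℂ)‖ = ‖μ‖ := norm_absMeas μ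
      have e2 : ∫ x, ‖g x‖ ^ 2 ∂ρ ≤ ‖star φ * φ‖ * ‖μ‖ := by
        have := le_norm (star φ * φ) (dens ρ fun _ => 1)
        rw [e1, n1, Complex.norm_of_nonneg (integral_nonneg fun x => by positivity)] at this
        exact this
      have e3 : ‖φ μ‖ ≤ ∫ x, ‖g x‖ ∂ρ := by
        rw [h, hg f hfi]
        refine (norm_integral_le_integral_norm _).trans (le_of_eq ?_)
        refine integral_congr_ae (Eventually.of_forall fun x => ?_)
        simp only [norm_mul, hf1, one_mul]
      have e4 : ∀ t : ℝ, 0 ≤ (∫ x, ‖g x‖ ^ 2 ∂ρ) - 2 * t * (∫ x, ‖g x‖ ∂ρ) + t ^ 2 * ‖μ‖ := by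
        intro t
        have h0 : 0 ≤ ∫ x, (‖g x‖ - t) ^ 2 ∂ρ := integral_nonneg fun x => sq_nonneg _
        have h5 : ∫ x, (‖g x‖ - t) ^ 2 ∂ρ =
            (∫ x, ‖g x‖ ^ 2 ∂ρ) - 2 * t * (∫ x, ‖g x‖ ∂ρ) + t ^ 2 * ‖μ‖ := by
          have h6 : ∀ x, (‖g x‖ - t) ^ 2 = ‖g x‖ ^ 2 - 2 * t * ‖g x‖ + t ^ 2 := fun x => by ring
          simp_rw [h6]
          have i3 : Integrable (fun x => 2 * t * ‖g x‖) ρ := gi.norm.const_mul _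
          have i4 : Integrable (fun x => ‖g x‖ ^ 2 - 2 * t * ‖g x‖) ρ := gi2.sub i3
          rw [integral_add i4 (integrable_const _), integral_sub gi2 i3, integral_const_mul,
            integral_const, smul_eq_mul, mul_comm (ρ.real Set.univ)]
          rfl
        rwa [h5] at h0
      have e5 : (∫ x, ‖g x‖ ∂ρ) ^ 2 ≤ (∫ x, ‖g x‖ ^ 2 ∂ρ) * ‖μ‖ := by
        have := discrim_le_zero (a := ‖μ‖) (b := -2 * ∫ x, ‖g x‖ ∂ρ)
          (c := ∫ x, ‖g x‖ ^ 2 ∂ρ) (fun t => by have := e4 t; nlinarith)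
        rw [discrim] at this
        nlinarith
      calc ‖φ μ‖ ^ 2 ≤ (∫ x, ‖g x‖ ∂ρ) ^ 2 := pow_le_pow_left₀ (norm_nonneg _) e3 2
        _ ≤ (∫ x, ‖g x‖ ^ 2 ∂ρ) * ‖μ‖ := e5
        _ ≤ (‖star φ * φ‖ * ‖μ‖) * ‖μ‖ := mul_le_mul_of_nonneg_right e2 (norm_nonneg _)
        _ = _ := by ring
    have h2 : ‖φ‖ ≤ Real.sqrt ‖star φ * φ‖ := by
      refine norm_le (Real.sqrt_nonneg _) fun μ => ?_
      refine abs_le_of_sq_le_sq' ?_ (by positivity) |>.2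
      rw [mul_pow, Real.sq_sqrt (norm_nonneg _)]
      exact key μ
    calc ‖φ‖ * ‖φ‖ ≤ Real.sqrt ‖star φ * φ‖ * Real.sqrt ‖star φ * φ‖ :=
          mul_le_mul h2 h2 (norm_nonneg _) (Real.sqrt_nonneg _)
      _ = _ := Real.mul_self_sqrt (norm_nonneg _)

instance : CStarAlgebra (MDual K) where

end MDual

end wstar

/-! ### Banach bimodules, F-algebras and left amenability -/

/-- A Banach `A`-bimodule structure on `X`: `left a x = a · x` and `right a x = x · a`. -/
structure BanachBimodule (A X : Type u) [NonUnitalNormedRing A] [NormedSpace ℂ A]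
    [NormedAddCommGroup X] [NormedSpace ℂ X] where
  left : A →L[ℂ] X →L[ℂ] X
  right : A →L[ℂ] X →L[ℂ] X
  left_mul : ∀ a b x, left (a * b) x = left a (left b x)
  right_mul : ∀ a b x, right (a * b) x = right b (right a x)
  left_right : ∀ a b x, left a (right b x) = right b (left a x)

namespace BanachBimodule

variable {A X : Type u} [NonUnitalNormedRing A] [NormedSpace ℂ A]
  [NormedAddCommGroup X] [NormedSpace ℂ X]

/-- The dual bimodule: `(a · φ)(x) = φ(x · a)` and `(φ · a)(x) = φ(a · x)`. -/
def dual (B : BanachBimodule A X) : BanachBimodule A (StrongDual ℂ X) where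
  left := (ContinuousLinearMap.compL ℂ X X ℂ).flip ∘L B.right
  right := (ContinuousLinearMap.compL ℂ X X ℂ).flip ∘L B.left
  left_mul a b φ := by ext x; simp [B.right_mul]
  right_mul a b φ := by ext x; simp [B.left_mul]
  left_right a b φ := by ext x; simp [B.left_right]

theorem dual_left_apply (B : BanachBimodule A X) (a : A) (φ : StrongDual ℂ X) (x : X) :
    B.dual.left a φ x = φ (B.right a x) := rfl

theorem dual_right_apply (B : BanachBimodule A X) (a : A) (φ : StrongDual ℂ X) (x : X) :
    B.dual.right a φ x = φ (B.left a x) := rfl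

/-- `D` is a (bounded) derivation: `D(ab) = D(a) · b + a · D(b)`. -/
def IsDerivation (B : BanachBimodule A X) (D : A →L[ℂ] X) : Prop :=
  ∀ a b, D (a * b) = B.right b (D a) + B.left a (D b)

/-- `D` is inner: `D(a) = a · x - x · a` for some `x`. -/
def IsInner (B : BanachBimodule A X) (D : A →L[ℂ] X) : Prop :=
  ∃ x, ∀ a, D a = B.left a x - B.right a x

end BanachBimodule

/-- An F-algebra (Lau algebra): a Banach algebra `A` that is the predual of a W*-algebra `M`
(a C*-algebra `M` with an isometric isomorphism `M ≃ A^*`) such that the identity of `M` is a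
multiplicative linear functional on `A`. -/
structure FAlgebra (A M : Type u) [NonUnitalNormedRing A] [NormedSpace ℂ A]
    [IsScalarTower ℂ A A] [SMulCommClass ℂ A A] [CompleteSpace A] [CStarAlgebra M] where
  toDual : M ≃ₗᵢ[ℂ] StrongDual ℂ A
  toDual_one_mul : ∀ a b : A, toDual 1 (a * b) = toDual 1 a * toDual 1 b

/-- Left amenability of an F-algebra: for each Banach `A`-bimodule `X` whose left action is
`a · x = ⟨a, e_M⟩ x`, every bounded derivation from `A` into `X^*` is inner. -/
def FAlgebra.LeftAmenable {A M : Type u} [NonUnitalNormedRing A] [NormedSpace ℂ A]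
    [IsScalarTower ℂ A A] [SMulCommClass ℂ A A] [CompleteSpace A] [CStarAlgebra M]
    (F : FAlgebra A M) : Prop :=
  ∀ (X : Type u) [NormedAddCommGroup X] [NormedSpace ℂ X] [CompleteSpace X]
    (B : BanachBimodule A X), (∀ a x, B.left a x = F.toDual 1 a • x) →
    ∀ D : A →L[ℂ] StrongDual ℂ X, B.dual.IsDerivation D → B.dual.IsInner D

/-! ### Invariant means and stationarity -/

section means

/-- A mean on `M(K)^*`: a positive linear functional of norm `1`, where `φ ≥ 0` means `φ(μ) ≥ 0`
for all `μ ∈ M⁺(K)`. -/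
def IsMean (m : StrongDual ℂ (StrongDual ℂ (RegMeas K))) : Prop :=
  ‖m‖ = 1 ∧ ∀ φ : StrongDual ℂ (RegMeas K), (∀ μ ∈ posMeas K, 0 ≤ φ μ) → 0 ≤ m φ

variable [LocallyCompactSpace K] [SemitopologicalSemihypergroup K]

/-- `L_μ φ : ν ↦ φ(μ * ν)`. -/
def leftTranslate (μ : RegMeas K) (φ : StrongDual ℂ (RegMeas K)) : StrongDual ℂ (RegMeas K) :=
  φ ∘L ContinuousLinearMap.mul ℂ (RegMeas K) μ

/-- `R_μ φ : ν ↦ φ(ν * μ)`. -/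
def rightTranslate (μ : RegMeas K) (φ : StrongDual ℂ (RegMeas K)) : StrongDual ℂ (RegMeas K) :=
  φ ∘L (ContinuousLinearMap.mul ℂ (RegMeas K)).flip μ

@[simp] theorem leftTranslate_apply (μ ν : RegMeas K) (φ : StrongDual ℂ (RegMeas K)) :
    leftTranslate μ φ ν = φ (μ * ν) := rfl

@[simp] theorem rightTranslate_apply (μ ν : RegMeas K) (φ : StrongDual ℂ (RegMeas K)) :
    rightTranslate μ φ ν = φ (ν * μ) := rfl

/-- A topological left invariant mean (TLIM). -/
def IsTLIM (m : StrongDual ℂ (StrongDual ℂ (RegMeas K))) : Prop :=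
  IsMean m ∧ ∀ ν ∈ probMeas K, ∀ φ : StrongDual ℂ (RegMeas K), m (leftTranslate ν φ) = m φ

variable (K)

/-- `K` is topological right stationary: there is a net `ν_α` in `P(K)` such that for every
`φ ∈ M(K)^*` there is a scalar `c` with `R_{ν_α} φ → c 𝟙` in the weak* topology. -/
def TopologicalRightStationary : Prop :=
  ∃ (J : Type u) (_ : Preorder J) (_ : IsDirectedOrder J) (_ : Nonempty J) (ν : J → RegMeas K),
    (∀ α, ν α ∈ probMeas K) ∧ ∀ φ : StrongDual ℂ (RegMeas K), ∃ c : ℂ,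
      Tendsto (fun α => StrongDual.toWeakDual (rightTranslate (ν α) φ)) atTop
        (𝓝 (StrongDual.toWeakDual (c • oneFunctional K)))

/-- `M(K)` as an F-algebra: the predual of the W*-algebra `M(K)^*`, whose identity is `𝟙`. -/
def measFAlgebra : FAlgebra (RegMeas K) (MDual K) where
  toDual := LinearIsometryEquiv.refl ℂ (StrongDual ℂ (RegMeas K))
  toDual_one_mul := mul_univ

theorem measFAlgebra_one : (measFAlgebra K).toDual 1 = oneFunctional K := rfl

end means

end
end SemiHyp

open SemiHyp

/-!
Every condition is compared with the existence of a proper filter of probability measures `ν` along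
which `‖ω * ν - ν‖ → 0` for all `ω ∈ P(K)` (`IsLeftInvariantFilter`); such filters and nets are
interchangeable (`exists_net_tendsto`). As `P(K)` spans `M(K)`, also `μ * ν - μ(K) ν → 0` in norm
for each `μ ∈ M(K)` along such a filter. With weak* compactness, this makes a limit of the point
evaluations `φ ↦ φ(ν)` a left invariant mean, `‖μ * ν‖` approach `|μ(K)|`, `R_ν φ` approach a
multiple of `𝟙` along an ultrafilter, and a weak* cluster point of `D ν` implement any given
derivation `D`.

The key converse is that a left invariant functional `n` on `M(K)^*` with `n(𝟙) ≠ 0`, not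
necessarily positive, produces such a filter (`exists_almost_invariant_probMeas`). If no `μ` had
mass near `1` and all `ω * μ - μ` small for finitely many `ω`, the Hahn-Banach theorem would give
functionals `φ_ω` with `∑ (L_ω φ_ω - φ_ω) + c 𝟙 = 0` and `c ≠ 0`, which `n` contradicts. The measure
`μ` found in this way is complex, but `|μ|` is still almost invariant
(`norm_mul_absMeas_sub_le`), and normalizing it gives a probability measure.

A mean is such an `n`. Left amenability yields one by means of a derivation of the form
`a ↦ a · p - a(K) p`, with values in the functionals on `M(K)^*` that annihilate `𝟙`. A stationary
net gives a left invariant mean as a limit of `σ * ν_α` for a fixed `σ ∈ P(K)`, since the limit of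
`φ(σ * ν_α)` does not depend on `σ`. The norm condition gives the filter by multiplying on the
right by one probability measure for each `ω` of a finite set.
-/

namespace SemiHyp

open scoped ENNReal NNReal ComplexOrder

noncomputable section

variable {K : Type u} [TopologicalSpace K] [T2Space K] [MeasurableSpace K] [BorelSpace K]

/-! ### Positive measures and total variation -/

theorem absMeas_apply (μ : RegMeas K) {E : Set K} (hE : MeasurableSet E) :
    absMeas μ E = ((μ.abs.real E : ℝ) : ℂ) := by
  rw [absMeas, dens_apply (integrable_const _) hE]
  simp

theorem absMeas_of_pos {μ : RegMeas K} (hμ : μ ∈ posMeas K) : absMeas μ = μ :=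
  RegMeas.ext fun E hE => by rw [absMeas_apply μ hE, abs_real_of_pos hμ hE]

theorem abs_real_le_add_sub (μ ν : RegMeas K) (E : Set K) :
    μ.abs.real E ≤ ν.abs.real E + (μ - ν).abs.real E := by
  have h : (ν + (μ - ν)).abs ≤ ν.abs + (μ - ν).abs :=
    VectorMeasure.variation_add_le (μ := ν.toComplex) (ν := (μ - ν).toComplex)
  rw [add_sub_cancel] at h
  rw [← measureReal_add_apply]
  exact ENNReal.toReal_mono (measure_ne_top _ _) (h _)

theorem abs_sub_comm (μ ν : RegMeas K) : (μ - ν).abs = (ν - μ).abs := by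
  rw [← neg_sub ν μ, ← neg_one_smul ℂ (ν - μ), measAbs_smul]
  simp

theorem norm_absMeas_sub_le (μ ν : RegMeas K) : ‖absMeas μ - absMeas ν‖ ≤ ‖μ - ν‖ := by
  have h : (absMeas μ - absMeas ν).abs ≤ (μ - ν).abs := by
    refine VectorMeasure.variation_le_of_forall_enorm_le fun E hE => ?_
    change ‖(absMeas μ - absMeas ν) E‖ₑ ≤ _
    rw [RegMeas.sub_apply, absMeas_apply μ hE, absMeas_apply ν hE, ← Complex.ofReal_sub,
      ← ofReal_norm, Complex.norm_real, ← ENNReal.ofReal_toReal (measure_ne_top (μ - ν).abs E)]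
    refine ENNReal.ofReal_le_ofReal (abs_sub_le_iff.2 ⟨?_, ?_⟩)
    · exact sub_le_iff_le_add'.2 (abs_real_le_add_sub μ ν E)
    · have := abs_real_le_add_sub ν μ E
      rw [abs_sub_comm ν μ] at this
      exact sub_le_iff_le_add'.2 this
  exact ENNReal.toReal_mono (measure_ne_top _ _) (h _)

theorem norm_of_mem_probMeas {μ : RegMeas K} (hμ : μ ∈ probMeas K) : ‖μ‖ = 1 := by
  have := norm_of_pos hμ.1
  rw [hμ.2] at this
  exact_mod_cast this

theorem smul_inv_norm_mem_probMeas {μ : RegMeas K} (hμ : μ ∈ posMeas K) (h0 : μ ≠ 0) :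
    ((‖μ‖⁻¹ : ℝ) : ℂ) • μ ∈ probMeas K := by
  refine ⟨posMeas_smul hμ (by exact_mod_cast inv_nonneg.2 (norm_nonneg μ)), ?_⟩
  rw [RegMeas.smul_apply, ← norm_of_pos hμ, ← Complex.ofReal_mul,
    inv_mul_cancel₀ (norm_ne_zero_iff.2 h0), Complex.ofReal_one]

theorem mem_span_probMeas (μ : RegMeas K) : μ ∈ Submodule.span ℂ (probMeas K) := by
  have hpos : ∀ ν ∈ posMeas K, ν ∈ Submodule.span ℂ (probMeas K) := by
    intro ν hν
    by_cases h0 : ν = 0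
    · rw [h0]; exact Submodule.zero_mem _
    have h1 : ((‖ν‖ : ℝ) : ℂ) • ((‖ν‖⁻¹ : ℝ) : ℂ) • ν = ν := by
      rw [smul_smul, ← Complex.ofReal_mul, mul_inv_cancel₀ (norm_ne_zero_iff.2 h0),
        Complex.ofReal_one, one_smul]
    rw [← h1]
    exact Submodule.smul_mem _ _ (Submodule.subset_span (smul_inv_norm_mem_probMeas hν h0))
  obtain ⟨μ₁, h1, μ₂, h2, μ₃, h3, rfl⟩ := exists_pos_decomp μ
  exact Submodule.add_mem _ (Submodule.sub_mem _ (hpos _ h1) (hpos _ h3))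
    (Submodule.smul_mem _ _ (Submodule.sub_mem _ (hpos _ h2) (hpos _ h3)))

/-! ### Means -/

/-- A mean that vanished at `𝟙` would be `0`: a functional `φ` that is real on `M⁺(K)` satisfies
`-‖φ‖ 𝟙 ≤ φ ≤ ‖φ‖ 𝟙`, and such functionals span `M(K)^*`. -/
theorem IsMean.apply_one_ne_zero {m : StrongDual ℂ (StrongDual ℂ (RegMeas K))} (hm : IsMean m) :
    m (oneFunctional K) ≠ 0 := by
  obtain ⟨hnorm, hpos⟩ := hm
  intro h1
  have key : ∀ φ : StrongDual ℂ (RegMeas K), (∀ μ ∈ posMeas K, (φ μ).im = 0) → m φ = 0 := by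
    intro φ hφ
    have hle : ∀ μ ∈ posMeas K, |(φ μ).re| ≤ ‖φ‖ * (μ Set.univ).re := by
      intro μ hμ
      rw [← norm_of_pos hμ, Complex.ofReal_re]
      exact (Complex.abs_re_le_norm _).trans (φ.le_opNorm μ)
    have him : ∀ μ ∈ posMeas K, (μ Set.univ).im = 0 := fun μ hμ => by
      rw [← norm_of_pos hμ, Complex.ofReal_im]
    have hp := hpos (((‖φ‖ : ℝ) : ℂ) • oneFunctional K + φ) fun μ hμ => by
      have := (abs_le.1 (hle μ hμ)).1
      rw [Complex.le_def]
      constructor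
      · simp; linarith
      · simp [him μ hμ, hφ μ hμ]
    have hn := hpos (((‖φ‖ : ℝ) : ℂ) • oneFunctional K - φ) fun μ hμ => by
      have := (abs_le.1 (hle μ hμ)).2
      rw [Complex.le_def]
      constructor
      · simp; linarith
      · simp [him μ hμ, hφ μ hμ]
    rw [map_add, map_smul, h1, smul_zero, zero_add] at hp
    rw [map_sub, map_smul, h1, smul_zero, zero_sub] at hn
    exact le_antisymm (neg_nonneg.1 hn) hp
  suffices h0 : m = 0 by
    have h := norm_zero (E := StrongDual ℂ (StrongDual ℂ (RegMeas K)))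
    rw [← h0] at h
    exact one_ne_zero (hnorm.symm.trans h)
  refine ContinuousLinearMap.ext fun φ => ?_
  have hstar : ∀ μ ∈ posMeas K, (star (φ : MDual K) : MDual K) μ = (starRingEnd ℂ) (φ μ) := by
    intro μ hμ
    have : MDual.conjMeas μ = μ := RegMeas.ext fun E _ => by
      rw [MDual.conjMeas_apply]
      exact Complex.conj_eq_iff_im.2 ((Complex.le_def.1 (hμ E)).2).symm
    refine (MDual.star_apply φ μ).trans ?_
    rw [this]
    rfl
  let ψ : StrongDual ℂ (RegMeas K) := (star (φ : MDual K) : MDual K)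
  have e1 := key (φ + ψ) fun μ hμ => by
    have : ψ μ = (starRingEnd ℂ) (φ μ) := hstar μ hμ
    simp [this]
  have e2 := key (Complex.I • (φ - ψ)) fun μ hμ => by
    have : ψ μ = (starRingEnd ℂ) (φ μ) := hstar μ hμ
    simp [this]
  rw [map_add] at e1
  rw [map_smul, map_sub, smul_eq_mul] at e2
  have e3 : m φ - m ψ = 0 := (mul_eq_zero.1 e2).resolve_left Complex.I_ne_zero
  have e4 : 2 * m φ = 0 := by linear_combination e1 + e3
  simpa using e4

/-- Weak* compactness: along an ultrafilter on `P(K)` the point evaluations converge to a mean. -/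
theorem exists_mean_of_ultrafilter (l : Ultrafilter (RegMeas K)) (hl : ∀ᶠ ν in l, ν ∈ probMeas K) :
    ∃ m : StrongDual ℂ (StrongDual ℂ (RegMeas K)), IsMean m ∧
      ∀ φ : StrongDual ℂ (RegMeas K), Tendsto (fun ν : RegMeas K => φ ν) l (𝓝 (m φ)) := by
  let ι : RegMeas K → WeakDual ℂ (StrongDual ℂ (RegMeas K)) := fun ν =>
    StrongDual.toWeakDual (NormedSpace.inclusionInDoubleDual ℂ (RegMeas K) ν)
  have hb : ∀ᶠ ν in l, ι ν ∈ WeakDual.toStrongDual ⁻¹'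
      Metric.closedBall (0 : StrongDual ℂ (StrongDual ℂ (RegMeas K))) 1 := by
    filter_upwards [hl] with ν hν
    exact (mem_closedBall_zero_iff (E := StrongDual ℂ (StrongDual ℂ (RegMeas K)))).2
      ((NormedSpace.double_dual_bound ℂ (RegMeas K) ν).trans (norm_of_mem_probMeas hν).le)
  obtain ⟨m, hm1, hm⟩ := (WeakDual.isCompact_closedBall (𝕜 := ℂ)
    (0 : StrongDual ℂ (StrongDual ℂ (RegMeas K))) 1).ultrafilter_le_nhds (l.map ι)
    (le_principal_iff.2 hb)
  have ht : ∀ φ : StrongDual ℂ (RegMeas K), Tendsto (fun ν : RegMeas K => φ ν) l (𝓝 (m φ)) :=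
    fun φ => ((WeakDual.eval_continuous φ).tendsto m).comp (show Tendsto ι l (𝓝 m) from hm)
  have hone : m (oneFunctional K) = 1 := by
    refine tendsto_nhds_unique (ht _) (tendsto_const_nhds.congr' ?_)
    filter_upwards [hl] with ν hν
    rw [oneFunctional_apply, hν.2]
  have hle : ‖WeakDual.toStrongDual m‖ ≤ 1 := mem_closedBall_zero_iff.1 hm1
  refine ⟨WeakDual.toStrongDual m, ⟨le_antisymm hle ?_, fun φ hφ => ?_⟩, ht⟩
  · have h1 := (WeakDual.toStrongDual m).le_opNorm (oneFunctional K)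
    have h2 : ‖oneFunctional K‖ ≤ 1 := LinearMap.mkContinuous_norm_le _ zero_le_one _
    have h3 : ‖(WeakDual.toStrongDual m) (oneFunctional K)‖ = 1 := by
      change ‖m (oneFunctional K)‖ = 1
      rw [hone, norm_one]
    rw [h3] at h1
    exact h1.trans (mul_le_of_le_one_right (norm_nonneg _) h2)
  · refine ge_of_tendsto (ht φ) ?_
    filter_upwards [hl] with ν hν
    exact hφ ν hν.1

/-- `φ ↦ φ - φ(p) 𝟙`, the projection of `M(K)^*` with kernel `ℂ 𝟙` onto the annihilator of `p`
(for `p(K) = 1`). -/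
def annProj (p : RegMeas K) : StrongDual ℂ (RegMeas K) →L[ℂ] StrongDual ℂ (RegMeas K) :=
  ContinuousLinearMap.id ℂ _ -
    (NormedSpace.inclusionInDoubleDual ℂ (RegMeas K) p).smulRight (oneFunctional K)

theorem annProj_apply (p : RegMeas K) (φ : StrongDual ℂ (RegMeas K)) :
    annProj p φ = φ - φ p • oneFunctional K := rfl

/-! ### Nets and filters -/

/-- A proper filter on `X` is refined by a net in `X`, indexed by the pairs of a set of the filter
and a point of this set. -/
theorem exists_net_tendsto {X : Type u} (l : Filter X) [l.NeBot] {S : Set X} (hS : S ∈ l) :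
    ∃ (J : Type u) (_ : Preorder J) (_ : IsDirectedOrder J) (_ : Nonempty J) (f : J → X),
      (∀ j, f j ∈ S) ∧ Tendsto f atTop l := by
  let J : Type u := {p : Set X × X // p.1 ∈ l ∧ p.2 ∈ p.1 ∧ p.2 ∈ S}
  let P : Preorder J := Preorder.lift fun p : J => OrderDual.toDual p.1.1
  have hle : ∀ {p q : J}, p ≤ q ↔ q.1.1 ⊆ p.1.1 := Iff.rfl
  have hex : ∀ s ∈ l, ∃ p : J, p.1.1 = s := fun s hs => by
    obtain ⟨x, hx⟩ := l.nonempty_of_mem (inter_mem hs hS)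
    exact ⟨⟨(s, x), hs, hx.1, hx.2⟩, rfl⟩
  refine ⟨J, P, ⟨fun p q => ?_⟩, ?_, fun p => p.1.2, fun p => p.2.2.2, ?_⟩
  · obtain ⟨r, hr⟩ := hex _ (inter_mem p.2.1 q.2.1)
    exact ⟨r, hle.2 (hr ▸ Set.inter_subset_left), hle.2 (hr ▸ Set.inter_subset_right)⟩
  · exact ⟨(hex _ univ_mem).choose⟩
  · intro s hs
    obtain ⟨p, hp⟩ := hex s hs
    refine mem_map.2 (mem_of_superset (mem_atTop p) fun q hq => ?_)
    have : q.1.1 ⊆ s := hp ▸ hle.1 hq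
    exact this q.2.2.1

/-! ### Left invariance -/

variable [LocallyCompactSpace K] [SemitopologicalSemihypergroup K]

theorem probMeas_mul {μ ν : RegMeas K} (hμ : μ ∈ probMeas K) (hν : ν ∈ probMeas K) :
    μ * ν ∈ probMeas K :=
  ⟨posMeas_mul hμ.1 hν.1, by rw [mul_univ, hμ.2, hν.2, mul_one]⟩

/-- Passing to total variations preserves approximate left invariance: `|ω * μ| ≤ ω * |μ|`, and the
difference of these positive measures has norm `‖μ‖ - ‖ω * μ‖ ≤ ‖ω * μ - μ‖`. -/
theorem norm_mul_absMeas_sub_le {ω : RegMeas K} (hω : ω ∈ probMeas K) (μ : RegMeas K) :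
    ‖ω * absMeas μ - absMeas μ‖ ≤ 2 * ‖ω * μ - μ‖ := by
  have hp := posMeas_mul hω.1 (absMeas_pos μ)
  have h1 : ω * absMeas μ - absMeas (ω * μ) ∈ posMeas K := by
    have h : (ω * μ).abs ≤ (ω * absMeas μ).abs := by
      refine VectorMeasure.variation_le_of_forall_enorm_le fun E hE => ?_
      rw [abs_apply_of_pos hp hE, ← ofReal_norm]
      have := norm_mul_apply_le ω μ E
      rw [absMeas_of_pos hω.1] at this
      exact ENNReal.ofReal_le_ofReal this
    intro E
    by_cases hE : MeasurableSet E
    · rw [RegMeas.sub_apply, absMeas_apply _ hE, ← abs_real_of_pos hp hE, sub_nonneg]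
      exact_mod_cast ENNReal.toReal_mono (measure_ne_top _ _) (h E)
    · rw [RegMeas.not_measurable _ hE]
  have h2 : ‖ω * absMeas μ - absMeas (ω * μ)‖ = ‖μ‖ - ‖ω * μ‖ := by
    have := norm_of_pos h1
    rw [RegMeas.sub_apply, ← norm_of_pos hp, ← norm_of_pos (absMeas_pos _), norm_absMeas,
      norm_mul_of_pos hω.1 (absMeas_pos μ), norm_absMeas, norm_of_mem_probMeas hω, one_mul] at this
    exact_mod_cast this
  have h3 : ‖μ‖ - ‖ω * μ‖ ≤ ‖ω * μ - μ‖ := by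
    rw [norm_sub_rev]
    exact norm_sub_norm_le _ _
  calc ‖ω * absMeas μ - absMeas μ‖
      = ‖(ω * absMeas μ - absMeas (ω * μ)) + (absMeas (ω * μ) - absMeas μ)‖ := by
        rw [sub_add_sub_cancel]
    _ ≤ ‖ω * absMeas μ - absMeas (ω * μ)‖ + ‖absMeas (ω * μ) - absMeas μ‖ := norm_add_le _ _
    _ ≤ ‖ω * μ - μ‖ + ‖ω * μ - μ‖ := add_le_add (h2.trans_le h3) (norm_absMeas_sub_le _ _)
    _ = _ := by ring

/-- A left invariant functional `n` on `M(K)^*` with `n(𝟙) ≠ 0` yields, by Hahn-Banach, measures of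
mass close to `1` that are almost invariant in norm. -/
theorem exists_almost_invariant {n : StrongDual ℂ (StrongDual ℂ (RegMeas K))}
    (h1 : n (oneFunctional K) ≠ 0)
    (hn : ∀ ω ∈ probMeas K, ∀ φ : StrongDual ℂ (RegMeas K), n (leftTranslate ω φ) = n φ)
    (F : Finset (RegMeas K)) (hF : ∀ ω ∈ F, ω ∈ probMeas K) {δ : ℝ} (hδ : 0 < δ) :
    ∃ μ : RegMeas K, (∀ ω ∈ F, ‖ω * μ - μ‖ < δ) ∧ ‖μ Set.univ - 1‖ < δ := by
  classical
  let T : RegMeas K →ₗ[ℂ] (F → RegMeas K) × ℂ := LinearMap.prod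
    (LinearMap.pi fun ω => LinearMap.mulLeft ℂ ω.1 - LinearMap.id) (evalL Set.univ)
  have hT : ∀ μ, T μ = (fun ω => ω.1 * μ - μ, μ Set.univ) := fun μ => rfl
  have hmem : ((0 : F → RegMeas K), (1 : ℂ)) ∈ closure (LinearMap.range T : Set _) := by
    by_contra hnot
    let S := (LinearMap.range T).topologicalClosure
    have : IsClosed (S : Set ((F → RegMeas K) × ℂ)) := Submodule.isClosed_topologicalClosure _
    have hne : S.mkQ (0, 1) ≠ 0 := by
      rw [Ne, Submodule.mkQ_apply, Submodule.Quotient.mk_eq_zero]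
      exact hnot
    obtain ⟨g, hg⟩ := SeparatingDual.exists_ne_zero (R := ℂ) hne
    let f : (F → RegMeas K) × ℂ →L[ℂ] ℂ := g ∘L S.mkQL
    have hf : ∀ μ, f (T μ) = 0 := by
      intro μ
      have : S.mkQ (T μ) = 0 := by
        rw [Submodule.mkQ_apply, Submodule.Quotient.mk_eq_zero]
        exact Submodule.le_topologicalClosure _ ⟨μ, rfl⟩
      change g (S.mkQ (T μ)) = 0
      rw [this, map_zero]
    let φ : F → StrongDual ℂ (RegMeas K) := fun ω =>
      f ∘L ContinuousLinearMap.inl ℂ _ _ ∘L ContinuousLinearMap.single ℂ (fun _ : F => RegMeas K) ω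
    have hsum : ∑ ω, (leftTranslate ω.1 (φ ω) - φ ω) + f (0, 1) • oneFunctional K = 0 := by
      refine ContinuousLinearMap.ext fun μ => ?_
      have e1 : T μ = (T μ).2 • ((0 : F → RegMeas K), (1 : ℂ)) + ((T μ).1, 0) := by
        ext <;> simp
      have e2 := ContinuousLinearMap.sum_comp_single ℂ (fun _ : F => RegMeas K)
        (f ∘L ContinuousLinearMap.inl ℂ _ _) (T μ).1
      have e3 := hf μ
      rw [e1, map_add, map_smul] at e3
      have e4 : f ((T μ).1, 0) = ∑ ω : F, φ ω (ω.1 * μ - μ) := e2.symm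
      rw [e4, hT] at e3
      simp only [map_sub] at e3
      simp only [add_apply, sum_apply,
        sub_apply, smul_apply, leftTranslate_apply,
        oneFunctional_apply, _root_.zero_apply]
      rw [← e3, smul_eq_mul, smul_eq_mul]
      ring
    have := congrArg n hsum
    rw [map_add, map_sum, map_smul, map_zero, Finset.sum_eq_zero, zero_add, smul_eq_mul] at this
    · exact (mul_ne_zero hg h1) this
    · intro ω _
      rw [map_sub, hn _ (hF _ ω.2), sub_self]
  obtain ⟨_, ⟨μ, rfl⟩, hμ⟩ := Metric.mem_closure_iff.1 hmem δ hδ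
  rw [dist_comm, dist_eq_norm, hT] at hμ
  refine ⟨μ, fun ω hω => ?_, (norm_snd_le _).trans_lt hμ⟩
  have h2 := (norm_fst_le _).trans_lt hμ
  simpa using (norm_le_pi_norm _ (⟨ω, hω⟩ : F)).trans_lt h2

theorem exists_almost_invariant_probMeas {n : StrongDual ℂ (StrongDual ℂ (RegMeas K))}
    (h1 : n (oneFunctional K) ≠ 0)
    (hn : ∀ ω ∈ probMeas K, ∀ φ : StrongDual ℂ (RegMeas K), n (leftTranslate ω φ) = n φ)
    (F : Finset (RegMeas K)) (hF : ∀ ω ∈ F, ω ∈ probMeas K) {ε : ℝ} (hε : 0 < ε) :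
    ∃ ν ∈ probMeas K, ∀ ω ∈ F, ‖ω * ν - ν‖ < ε := by
  obtain ⟨μ, hμ, hmass⟩ := exists_almost_invariant h1 hn F hF
    (δ := min (1 / 2) (ε / 4)) (lt_min (by norm_num) (by linarith))
  have hnorm : 1 / 2 ≤ ‖absMeas μ‖ := by
    have h2 : ‖(1 : ℂ)‖ ≤ ‖μ Set.univ‖ + ‖μ Set.univ - 1‖ := by
      rw [norm_sub_rev]
      simpa using norm_add_le (μ Set.univ) (1 - μ Set.univ)
    rw [norm_one] at h2
    have h3 := RegMeas.norm_apply_le μ Set.univ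
    have h4 := hmass.trans_le (min_le_left _ _)
    rw [norm_absMeas]
    linarith
  have hpos : 0 < ‖absMeas μ‖ := by linarith
  refine ⟨_, smul_inv_norm_mem_probMeas (absMeas_pos μ) (norm_pos_iff.1 hpos), fun ω hω => ?_⟩
  rw [mul_smul_comm, ← smul_sub, norm_smul, Complex.norm_real, norm_inv, norm_norm,
    inv_mul_lt_iff₀ hpos]
  have h5 := norm_mul_absMeas_sub_le (hF ω hω) μ
  have h6 := (hμ ω hω).trans_le (min_le_right _ _)
  nlinarith

variable (K)

/-- `l` is a proper filter of probability measures that converges to left invariance in norm. -/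
structure IsLeftInvariantFilter (l : Filter (RegMeas K)) : Prop where
  neBot : l.NeBot
  prob : ∀ᶠ ν in l, ν ∈ probMeas K
  tendsto : ∀ ω ∈ probMeas K, Tendsto (fun ν => ‖ω * ν - ν‖) l (𝓝 0)

variable {K}

theorem IsLeftInvariantFilter.mono {l l' : Filter (RegMeas K)} (h : IsLeftInvariantFilter K l)
    (h' : l'.NeBot) (hle : l' ≤ l) : IsLeftInvariantFilter K l' :=
  ⟨h', hle h.prob, fun ω hω => (h.tendsto ω hω).mono_left hle⟩

theorem exists_isLeftInvariantFilter_of_almost_invariant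
    (h : ∀ F : Finset (RegMeas K), (∀ ω ∈ F, ω ∈ probMeas K) → ∀ ε : ℝ, 0 < ε →
      ∃ ν ∈ probMeas K, ∀ ω ∈ F, ‖ω * ν - ν‖ < ε) :
    ∃ l, IsLeftInvariantFilter K l := by
  classical
  have h' : ∀ p : Finset (probMeas K) × ℕ, ∃ ν ∈ probMeas K,
      ∀ ω ∈ p.1, ‖ω.1 * ν - ν‖ < 1 / ((p.2 : ℝ) + 1) := fun p => by
    obtain ⟨ν, hν, hp⟩ := h (p.1.image Subtype.val)
      (fun ω hω => by obtain ⟨x, _, rfl⟩ := Finset.mem_image.1 hω; exact x.2)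
      (1 / ((p.2 : ℝ) + 1)) Nat.one_div_pos_of_nat
    exact ⟨ν, hν, fun ω hω => hp _ (Finset.mem_image_of_mem _ hω)⟩
  choose ν hν hp using h'
  refine ⟨atTop.map ν, inferInstance, eventually_map.2 (Eventually.of_forall hν), fun ω hω => ?_⟩
  refine tendsto_map'_iff.2 (squeeze_zero' (Eventually.of_forall fun p => norm_nonneg _) ?_
    (tendsto_one_div_add_atTop_nhds_zero_nat.comp (tendsto_snd.mono_left
      (prod_atTop_atTop_eq (α := Finset (probMeas K)) (β := ℕ)).ge)))
  filter_upwards [mem_atTop (({⟨ω, hω⟩}, 0) : Finset (probMeas K) × ℕ)] with p hle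
  exact (hp p ⟨ω, hω⟩ (hle.1 (Finset.mem_singleton_self _))).le

/-- Since `P(K)` spans `M(K)`, a left invariant filter of probability measures satisfies
`μ * ν - μ(K) ν → 0` for every `μ ∈ M(K)`. -/
theorem IsLeftInvariantFilter.tendsto_mul {l : Filter (RegMeas K)} (h : IsLeftInvariantFilter K l)
    (μ : RegMeas K) : Tendsto (fun ν => μ * ν - μ Set.univ • ν) l (𝓝 0) := by
  induction mem_span_probMeas μ using Submodule.span_induction with
  | mem μ hμ =>
    rw [tendsto_zero_iff_norm_tendsto_zero]
    simpa [hμ.2] using h.tendsto μ hμ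
  | zero => simpa using tendsto_const_nhds
  | add μ μ' _ _ h1 h2 =>
    simpa [add_mul, add_smul, add_sub_add_comm] using h1.add h2
  | smul c μ _ h1 =>
    simpa [smul_mul_assoc, mul_smul, smul_sub] using h1.const_smul c

/-- A left invariant ultrafilter of probability measures converges to a left invariant mean. -/
theorem IsLeftInvariantFilter.exists_isTLIM {l : Ultrafilter (RegMeas K)}
    (h : IsLeftInvariantFilter K l) : ∃ m : StrongDual ℂ (StrongDual ℂ (RegMeas K)), IsTLIM m ∧
      ∀ φ : StrongDual ℂ (RegMeas K), Tendsto (fun ν : RegMeas K => φ ν) l (𝓝 (m φ)) := by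
  obtain ⟨m, hm, ht⟩ := exists_mean_of_ultrafilter l h.prob
  refine ⟨m, ⟨hm, fun ω hω φ => ?_⟩, ht⟩
  have h1 : Tendsto (fun ν : RegMeas K => φ (ω * ν - ω Set.univ • ν)) l (𝓝 0) := by
    have := (φ.continuous.tendsto 0).comp (h.tendsto_mul ω)
    rwa [map_zero] at this
  refine tendsto_nhds_unique (ht (leftTranslate ω φ)) ?_
  simpa [hω.2] using h1.add (ht φ)

theorem exists_isTLIM_iff : (∃ m : StrongDual ℂ (StrongDual ℂ (RegMeas K)), IsTLIM m) ↔
    ∃ l, IsLeftInvariantFilter K l := by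
  constructor
  · rintro ⟨m, hm, hinv⟩
    exact exists_isLeftInvariantFilter_of_almost_invariant fun F hF ε hε =>
      exists_almost_invariant_probMeas hm.apply_one_ne_zero hinv F hF hε
  · rintro ⟨l, hl⟩
    have := hl.neBot
    obtain ⟨m, hm, -⟩ := (hl.mono (Ultrafilter.of l).neBot (Ultrafilter.of_le l)).exists_isTLIM
    exact ⟨m, hm⟩

theorem exists_net_iff_exists_isLeftInvariantFilter :
    (∃ (J : Type u) (_ : Preorder J) (_ : IsDirectedOrder J) (_ : Nonempty J)
        (ν : J → RegMeas K), (∀ α, ν α ∈ probMeas K) ∧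
        ∀ ω ∈ probMeas K, Tendsto (fun α => ‖ω * ν α - ν α‖) atTop (𝓝 0)) ↔
    ∃ l, IsLeftInvariantFilter K l := by
  constructor
  · rintro ⟨J, _, _, _, ν, hν, h⟩
    exact ⟨atTop.map ν, inferInstance, eventually_map.2 (Eventually.of_forall hν),
      fun ω hω => tendsto_map'_iff.2 (h ω hω)⟩
  · rintro ⟨l, hl⟩
    have := hl.neBot
    obtain ⟨J, i1, i2, i3, ν, hν, ht⟩ := exists_net_tendsto l hl.prob
    exact ⟨J, i1, i2, i3, ν, hν, fun ω hω => (hl.tendsto ω hω).comp ht⟩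

/-! ### The norm condition -/

/-- The measures `ω * σ - σ` have mass `0`, so the norm condition makes them small one after the
other by right multiplication, which does not increase the norms that are already small. -/
theorem exists_isLeftInvariantFilter_iff_isGLB [Nonempty K] :
    (∃ l, IsLeftInvariantFilter K l) ↔
    ∀ μ : RegMeas K, IsGLB ((fun ν => ‖μ * ν‖) '' probMeas K) ‖μ Set.univ‖ := by
  classical
  constructor
  · rintro ⟨l, hl⟩ μ
    have := hl.neBot
    constructor
    · rintro _ ⟨ν, hν, rfl⟩
      have h := RegMeas.norm_apply_le (μ * ν) Set.univ
      rwa [mul_univ, hν.2, mul_one] at h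
    · intro b hb
      have h1 : Tendsto (fun ν => ‖μ * ν - μ Set.univ • ν‖ + ‖μ Set.univ‖) l
          (𝓝 ‖μ Set.univ‖) := by
        simpa using (hl.tendsto_mul μ).norm.add_const ‖μ Set.univ‖
      refine ge_of_tendsto h1 ?_
      filter_upwards [hl.prob] with ν hν
      have h2 : ‖μ * ν‖ ≤ ‖μ * ν - μ Set.univ • ν‖ + ‖μ Set.univ • ν‖ := by
        simpa using norm_add_le (μ * ν - μ Set.univ • ν) (μ Set.univ • ν)
      rw [norm_smul, norm_of_mem_probMeas hν, mul_one] at h2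
      exact (hb ⟨ν, hν, rfl⟩).trans h2
  · intro h
    refine exists_isLeftInvariantFilter_of_almost_invariant fun F => ?_
    induction F using Finset.induction_on with
    | empty =>
      intro _ ε _
      exact ⟨_, pointMass_mem (Classical.arbitrary K), by simp⟩
    | insert ω F _ ih =>
      intro hF ε hε
      obtain ⟨σ, hσ, hsmall⟩ := ih (fun τ hτ => hF τ (Finset.mem_insert_of_mem hτ)) ε hε
      have hω := hF ω (Finset.mem_insert_self _ _)
      have h0 : (ω * σ - σ) Set.univ = 0 := by
        rw [RegMeas.sub_apply, mul_univ, hω.2, hσ.2, one_mul, sub_self]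
      have hglb := h (ω * σ - σ)
      rw [h0, norm_zero] at hglb
      obtain ⟨_, ⟨ν, hν, rfl⟩, -, hlt⟩ := hglb.exists_between hε
      refine ⟨σ * ν, probMeas_mul hσ hν, fun τ hτ => ?_⟩
      rw [← mul_assoc, ← sub_mul]
      rcases Finset.mem_insert.1 hτ with rfl | hτ
      · exact hlt
      · refine (norm_mul_le _ _).trans_lt ?_
        rw [norm_of_mem_probMeas hν, mul_one]
        exact hsmall τ hτ

/-! ### Stationarity -/

theorem topologicalRightStationary_iff [Nonempty K] : TopologicalRightStationary K ↔
    ∃ m : StrongDual ℂ (StrongDual ℂ (RegMeas K)), IsTLIM m := by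
  constructor
  · rintro ⟨J, _, _, _, ν, hν, h⟩
    choose c hc using h
    let σ : RegMeas K := RegMeas.pointMass (Classical.arbitrary K)
    have hσ : σ ∈ probMeas K := pointMass_mem _
    let u : Ultrafilter J := Ultrafilter.of atTop
    have htu : ∀ (μ : RegMeas K) (φ : StrongDual ℂ (RegMeas K)),
        Tendsto (fun α => φ (μ * ν α)) u (𝓝 (c φ * μ Set.univ)) := fun μ φ =>
      (((WeakDual.eval_continuous μ).tendsto _).comp (hc φ)).mono_left (Ultrafilter.of_le atTop)
    obtain ⟨m, hm, ht⟩ := exists_mean_of_ultrafilter (u.map fun α => σ * ν α)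
      (Eventually.of_forall fun α => probMeas_mul hσ (hν α) : ∀ᶠ α in u, σ * ν α ∈ probMeas K)
    -- The mean takes the value `c φ` at `φ`, whichever `σ ∈ P(K)` is used.
    have hmc : ∀ φ, m φ = c φ := fun φ => by
      have h2 := htu σ φ
      rw [hσ.2, mul_one] at h2
      exact tendsto_nhds_unique
        (show Tendsto (fun α => φ (σ * ν α)) u (𝓝 (m φ)) from ht φ) h2
    refine ⟨m, hm, fun ω hω φ => ?_⟩
    have h3 := htu (ω * σ) φ
    rw [(probMeas_mul hω hσ).2, mul_one, ← hmc] at h3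
    refine tendsto_nhds_unique
      (show Tendsto (fun α => leftTranslate ω φ (σ * ν α)) u _ from ht (leftTranslate ω φ)) ?_
    simpa [mul_assoc] using h3
  · intro h
    obtain ⟨l₀, hl₀⟩ := exists_isTLIM_iff.1 h
    have := hl₀.neBot
    let l := Ultrafilter.of l₀
    have hl : IsLeftInvariantFilter K l := hl₀.mono l.neBot (Ultrafilter.of_le l₀)
    obtain ⟨m, -, ht⟩ := hl.exists_isTLIM
    obtain ⟨J, i1, i2, i3, ν, hν, hnet⟩ := exists_net_tendsto (l : Filter (RegMeas K)) hl.prob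
    refine ⟨J, i1, i2, i3, ν, hν, fun φ => ⟨m φ, ?_⟩⟩
    refine tendsto_iff_forall_eval_tendsto_topDualPairing.2 fun μ => ?_
    have h1 : Tendsto (fun ν : RegMeas K => φ (μ * ν - μ Set.univ • ν)) l (𝓝 0) := by
      have := (φ.continuous.tendsto 0).comp (hl.tendsto_mul μ)
      rwa [map_zero] at this
    have h2 := (h1.add ((ht φ).const_mul (μ Set.univ))).comp hnet
    simp only [map_sub, map_smul, smul_eq_mul, sub_add_cancel, zero_add] at h2
    change Tendsto (fun α => φ (μ * ν α)) atTop (𝓝 (m φ * μ Set.univ))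
    rw [mul_comm]
    exact h2

/-! ### Left amenability -/

/-- For a bimodule with left action `a · x = a(K) x` and a derivation `D` into its dual, any weak*
cluster point `f` of `D` along a left invariant filter of probability measures satisfies
`D a = a(K) f - a · f`. -/
theorem IsLeftInvariantFilter.leftAmenable {l₀ : Filter (RegMeas K)}
    (hl₀ : IsLeftInvariantFilter K l₀) : (measFAlgebra K).LeftAmenable := by
  intro X _ _ _ B hB D hD
  have := hl₀.neBot
  let l := Ultrafilter.of l₀
  have hl : IsLeftInvariantFilter K l := hl₀.mono l.neBot (Ultrafilter.of_le l₀)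
  let d : RegMeas K → WeakDual ℂ X := fun ν => StrongDual.toWeakDual (D ν)
  have hb : ∀ᶠ ν in l, d ν ∈ WeakDual.toStrongDual ⁻¹'
      Metric.closedBall (0 : StrongDual ℂ X) ‖D‖ := by
    filter_upwards [hl.prob] with ν hν
    change D ν ∈ Metric.closedBall _ _
    rw [mem_closedBall_zero_iff]
    simpa [norm_of_mem_probMeas hν] using D.le_opNorm ν
  obtain ⟨f, -, hf⟩ := (WeakDual.isCompact_closedBall (𝕜 := ℂ)
    (0 : StrongDual ℂ X) ‖D‖).ultrafilter_le_nhds (l.map d) (le_principal_iff.2 hb)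
  have ht : ∀ x : X, Tendsto (fun ν => D ν x) l (𝓝 (f x)) :=
    fun x => ((WeakDual.eval_continuous x).tendsto f).comp (show Tendsto d l (𝓝 f) from hf)
  refine ⟨-WeakDual.toStrongDual f, fun a => ContinuousLinearMap.ext fun x => ?_⟩
  have hBa : ∀ x, B.left a x = a Set.univ • x := hB a
  -- `D (a * ν) x` tends to `a(K) f x` and equals `D a x + D ν (x · a)` for `ν ∈ P(K)`.
  have h1 : Tendsto (fun ν => D (a * ν - a Set.univ • ν) x) l (𝓝 0) := by
    have hc : Continuous fun ν : RegMeas K => D ν x := by fun_prop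
    have := (hc.tendsto 0).comp (hl.tendsto_mul a)
    rwa [map_zero, _root_.zero_apply] at this
  have h2 : Tendsto (fun ν => D (a * ν - a Set.univ • ν) x) l
      (𝓝 (D a x + f (B.right a x) - a Set.univ * f x)) := by
    refine (((ht (B.right a x)).const_add (D a x)).sub ((ht x).const_mul (a Set.univ))).congr' ?_
    filter_upwards [hl.prob] with ν hν
    have hBν : B.left ν x = ν Set.univ • x := hB ν x
    rw [map_sub, map_smul, hD a ν]
    simp [BanachBimodule.dual_left_apply, BanachBimodule.dual_right_apply, hBν, hν.2]
  have h3 := tendsto_nhds_unique h1 h2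
  simp only [sub_apply, BanachBimodule.dual_left_apply,
    BanachBimodule.dual_right_apply, hBa, neg_apply, map_smul, smul_eq_mul]
  change D a x = -f (B.right a x) - a Set.univ * -f x
  linear_combination -h3

/-- Left translation as a bounded bilinear map. -/
def leftTranslateL :
    RegMeas K →L[ℂ] StrongDual ℂ (RegMeas K) →L[ℂ] StrongDual ℂ (RegMeas K) :=
  (ContinuousLinearMap.compL ℂ (RegMeas K) (RegMeas K) ℂ).flip ∘L ContinuousLinearMap.mul ℂ _

theorem leftTranslateL_apply (a : RegMeas K) (φ : StrongDual ℂ (RegMeas K)) :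
    leftTranslateL a φ = leftTranslate a φ := rfl

theorem leftTranslate_one (a : RegMeas K) :
    leftTranslate a (oneFunctional K) = a Set.univ • oneFunctional K :=
  ContinuousLinearMap.ext fun ν => mul_univ a ν

/-- The bimodule `M(K)^*` with left action `a · φ = a(K) φ` and right action
`φ · a = L_a φ - φ(a * p) 𝟙`. This is a copy of `M(K)^* / ℂ 𝟙` with the action by translations,
realized without passing to the quotient. -/
def annBimodule {p : RegMeas K} (hp : p ∈ probMeas K) :
    BanachBimodule (RegMeas K) (StrongDual ℂ (RegMeas K)) where
  left := (oneFunctional K).smulRight (ContinuousLinearMap.id ℂ _)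
  right := (ContinuousLinearMap.compL ℂ _ _ _ (annProj p)) ∘L leftTranslateL
  left_mul a b φ := by
    simp [mul_univ, mul_smul, smul_comm (a Set.univ)]
  right_mul a b φ := by
    refine ContinuousLinearMap.ext fun ν => ?_
    simp only [ContinuousLinearMap.comp_apply, ContinuousLinearMap.compL_apply,
      leftTranslateL_apply, annProj_apply, sub_apply, smul_apply,
      leftTranslate_apply, oneFunctional_apply, mul_univ, hp.2, mul_assoc, smul_eq_mul]
    ring
  left_right a b φ := by
    simp

/-- The derivation `a ↦ a · p - a(K) p` takes values in the annihilator of `𝟙`. If it is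
implemented by `f` on `annBimodule`, then `f` annihilates `𝟙` too, and `n = p - f` is left
invariant. -/
theorem exists_invariant_of_leftAmenable [Nonempty K] (h : (measFAlgebra K).LeftAmenable) :
    ∃ n : StrongDual ℂ (StrongDual ℂ (RegMeas K)), n (oneFunctional K) = 1 ∧
      ∀ ω ∈ probMeas K, ∀ φ : StrongDual ℂ (RegMeas K), n (leftTranslate ω φ) = n φ := by
  let p : RegMeas K := RegMeas.pointMass (Classical.arbitrary K)
  have hp : p ∈ probMeas K := pointMass_mem _
  let J := NormedSpace.inclusionInDoubleDual ℂ (RegMeas K)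
  let D : RegMeas K →L[ℂ] StrongDual ℂ (StrongDual ℂ (RegMeas K)) :=
    J ∘L ((ContinuousLinearMap.mul ℂ (RegMeas K)).flip p - (oneFunctional K).smulRight p)
  have hDa : ∀ a φ, D a φ = φ (a * p) - a Set.univ * φ p := fun a φ => by
    change φ (a * p - a Set.univ • p) = _
    rw [map_sub, map_smul, smul_eq_mul]
  have hleft : ∀ a φ, (annBimodule hp).left a φ = a Set.univ • φ := fun a φ => rfl
  have hright : ∀ a φ, (annBimodule hp).right a φ =
      leftTranslate a φ - φ (a * p) • oneFunctional K := fun a φ => rfl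
  obtain ⟨f, hf⟩ := h _ (annBimodule hp) (fun a φ => hleft a φ) D fun a b =>
    ContinuousLinearMap.ext fun φ => by
      rw [add_apply, BanachBimodule.dual_left_apply, BanachBimodule.dual_right_apply, hDa, hDa,
        hDa, hleft, hright]
      simp only [sub_apply, smul_apply, leftTranslate_apply,
        oneFunctional_apply, mul_univ, hp.2, mul_assoc, smul_eq_mul]
      ring
  have hf' : ∀ ω ∈ probMeas K, ∀ φ, φ (ω * p) - φ p =
      f (leftTranslate ω φ) - φ (ω * p) * f (oneFunctional K) - f φ := fun ω hω φ => by
    have := congrArg (fun F => F φ) (hf ω)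
    simp only [sub_apply, BanachBimodule.dual_left_apply, BanachBimodule.dual_right_apply, hDa,
      hleft, hright, map_sub, map_smul, smul_eq_mul, hω.2, one_mul] at this
    exact this
  have hf1 : f (oneFunctional K) = 0 := by
    have := hf' p hp (oneFunctional K)
    rw [leftTranslate_one, oneFunctional_apply, oneFunctional_apply, mul_univ, hp.2, one_smul]
      at this
    linear_combination this
  refine ⟨J p - f, ?_, fun ω hω φ => ?_⟩
  · change p Set.univ - f (oneFunctional K) = 1
    rw [hf1, hp.2, sub_zero]
  · change φ (ω * p) - f (leftTranslate ω φ) = φ p - f φ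
    have := hf' ω hω φ
    rw [hf1] at this
    linear_combination this

theorem leftAmenable_iff [Nonempty K] :
    (measFAlgebra K).LeftAmenable ↔ ∃ l, IsLeftInvariantFilter K l := by
  refine ⟨fun h => ?_, fun ⟨l, hl⟩ => hl.leftAmenable⟩
  obtain ⟨n, h1, hn⟩ := exists_invariant_of_leftAmenable h
  exact exists_isLeftInvariantFilter_of_almost_invariant fun F hF ε hε =>
    exists_almost_invariant_probMeas (h1.trans_ne one_ne_zero) hn F hF hε

end

end SemiHyp

theorem mainTheorem1 {K : Type u} [TopologicalSpace K] [T2Space K] [LocallyCompactSpace K]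
    [MeasurableSpace K] [BorelSpace K] [Nonempty K] [SemitopologicalSemihypergroup K] :
    List.TFAE [
      ∃ m : StrongDual ℂ (StrongDual ℂ (RegMeas K)), IsTLIM m,
      ∃ (J : Type u) (_ : Preorder J) (_ : IsDirectedOrder J) (_ : Nonempty J)
        (ν : J → RegMeas K), (∀ α, ν α ∈ probMeas K) ∧
        ∀ ω ∈ probMeas K, Tendsto (fun α => ‖ω * ν α - ν α‖) atTop (𝓝 0),
      ∀ μ : RegMeas K, IsGLB ((fun ν => ‖μ * ν‖) '' probMeas K) ‖μ Set.univ‖,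
      TopologicalRightStationary K,
      (measFAlgebra K).LeftAmenable] := by
  tfae_have 1 ↔ 2 := exists_isTLIM_iff.trans exists_net_iff_exists_isLeftInvariantFilter.symm
  tfae_have 1 ↔ 3 := exists_isTLIM_iff.trans exists_isLeftInvariantFilter_iff_isGLB
  tfae_have 4 ↔ 1 := topologicalRightStationary_iff
  tfae_have 1 ↔ 5 := exists_isTLIM_iff.trans leftAmenable_iff.symm
  tfae_finish
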